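/- Let $n\ge 0$, $\widehat{\mathcal O}=\mathbb C[[x_1,\dots,x_n]]$ with maximal ideal $\mathfrak m$, and let $\widehat{\mathrm{Der}}$ be the $\widehat{\mathcal O}$-module of $\mathbb C$-derivations of $\widehat{\mathcal O}$. For $f\in\widehat{\mathcal O}$ put $\mathrm{Der}_f=\{\delta\in\widehat{\mathrm{Der}} : \delta(f)\in(f)\}$. A derivation $\delta\in\mathfrak m\widehat{\mathrm{Der}}$ induces a $\mathbb C$-linear endomorphism $\delta^{(k)}$ of $\widehat{\mathcal O}/\mathfrak m^k$ for every $k\in\mathbb N$; call $\delta$ semisimple if every $\delta^{(k)}$ is diagonalizable, and topologically nilpotent if every $\delta^{(k)}$ is nilpotent. A formal coordinate system is an $n$-tuple $(y_1,\dots,y_n)$ generating $\mathfrak m$, with associated partial derivatives $\partial/\partial y_j$, the derivations satisfying $\partial y_i/\partial y_j=\delta_{ij}$. Generating sets of $\mathrm{Der}_f$ are generating sets as an $\widehat{\mathcal O}$-module, and minimality is with respect to inclusion. **Theorem.** Let $f\in\widehat{\mathcal O}$ be such that $\mathrm{Der}_f\subset\mathfrak m\widehat{\mathrm{Der}}$.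 Then there is a maximal number $s\ge 0$ of pairwise commuting semisimple derivations contained in one minimal generating set of $\mathrm{Der}_f$ (the maximum being taken over all minimal generating sets). If $s=0$, then every minimal generating set of $\mathrm{Der}_f$ consists of topologically nilpotent derivations. If $s\ge 1$, then there exist an integer $r\ge 0$, a minimal generating set $\{\sigma_1,\dots,\sigma_s,\nu_1,\dots,\nu_r\}$ of $\mathrm{Der}_f$ (with these $s+r$ elements distinct), a formal coordinate system $(y_1,\dots,y_n)$ and a unit $u\in\widehat{\mathcal O}$ such that 1. $\sigma_i=\sum_{j=1}^n w_{ij}\,y_j\,\dfrac{\partial}{\partial y_j}$ with $w_{ij}\in\mathbb Q$ for all $i=1,\dots,s$ and $j=1,\dots,n$; 2. for $g=uf$ we have $\sigma_i(g)=\alpha_i g$ with $\alpha_i\in\mathbb Q$ for all $i=1,\dots,s$; 3. $\nu_1,\dots,\nu_r$ are topologically nilpotent; 4. $[\sigma_i,\nu_j]=c_{ij}\nu_j$ with $c_{ij}\in\mathbb Q$ for all $i=1,\dots,s$ and $j=1,\dots,r$. -/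

import Mathlib

namespace FormalLog

open IsLocalRing

/-- The ring `ℂ[[x₁, …, xₙ]]` of formal power series. -/
abbrev FPS (n : ℕ) : Type := MvPowerSeries (Fin n) ℂ

/-- The `ℂ[[x]]`-module of `ℂ`-derivations of `ℂ[[x]]`; it is a Lie ring under the commutator. -/
abbrev Der (n : ℕ) : Type := Derivation ℂ (FPS n) (FPS n)

/-- The submodule `𝔪 · Der` of singular derivations. -/
noncomputable def singularDer (n : ℕ) : Submodule (FPS n) (Der n) :=
  maximalIdeal (FPS n) • (⊤ : Submodule (FPS n) (Der n))

/-- The module `Der_f` of logarithmic derivations: those `δ` with `δ(f) ∈ (f)`. -/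
def logDer {n : ℕ} (f : FPS n) : Submodule (FPS n) (Der n) where
  carrier := {δ | δ f ∈ Ideal.span {f}}
  zero_mem' := by simp
  add_mem' := fun {a b} ha hb => by
    simpa using (Ideal.span {f}).add_mem ha hb
  smul_mem' := fun c a ha => by
    simpa using (Ideal.span {f}).mul_mem_left c ha

/-- `𝔪 ^ k`, seen as a complex vector subspace of `ℂ[[x]]`. -/
noncomputable def maxPow (n k : ℕ) : Submodule ℂ (FPS n) :=
  (maximalIdeal (FPS n) ^ k).restrictScalars ℂ

lemma apply_mem_maximalIdeal {n : ℕ} {δ : Der n} (h : δ ∈ singularDer n) (g : FPS n) :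
    δ g ∈ maximalIdeal (FPS n) := by
  unfold singularDer at h
  refine Submodule.smul_induction_on h ?_ ?_
  · intro r hr d _
    simpa using Ideal.mul_mem_right (d g) _ hr
  · intro a b ha hb
    simpa using Ideal.add_mem _ ha hb

/-- A singular derivation leaves every power of the maximal ideal invariant. -/
lemma maxPow_le_comap {n : ℕ} {δ : Der n} (h : δ ∈ singularDer n) (k : ℕ) :
    maxPow n k ≤ (maxPow n k).comap (δ : FPS n →ₗ[ℂ] FPS n) := by
  induction k with
  | zero => intro x _; simp [maxPow]
  | succ k ih =>
    intro x hx
    have hx' : x ∈ maximalIdeal (FPS n) ^ k * maximalIdeal (FPS n) := by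
      rw [← pow_succ]; exact hx
    change δ x ∈ maximalIdeal (FPS n) ^ (k + 1)
    refine Submodule.mul_induction_on hx' ?_ ?_
    · intro a ha b hb
      have h1 : δ a ∈ maximalIdeal (FPS n) ^ k := ih ha
      rw [Derivation.leibniz, pow_succ]
      refine Ideal.add_mem _ (Ideal.mul_mem_mul ha (apply_mem_maximalIdeal h b)) ?_
      rw [smul_eq_mul, mul_comm b]
      exact Ideal.mul_mem_mul h1 hb
    · intro a b ha hb
      rw [map_add]
      exact Ideal.add_mem _ ha hb

/-- The `ℂ`-linear endomorphism of `ℂ[[x]] / 𝔪 ^ k` induced by a singular derivation. -/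
noncomputable def inducedMap {n : ℕ} (δ : Der n) (h : δ ∈ singularDer n) (k : ℕ) :
    Module.End ℂ (FPS n ⧸ maxPow n k) :=
  (maxPow n k).mapQ (maxPow n k) (δ : FPS n →ₗ[ℂ] FPS n) (maxPow_le_comap h k)

/-- An endomorphism is diagonalizable if its eigenspaces span the whole space. -/
def IsDiagonalizable {V : Type*} [AddCommGroup V] [Module ℂ V] (T : Module.End ℂ V) : Prop :=
  ⨆ μ : ℂ, T.eigenspace μ = ⊤

/-- A singular derivation is semisimple if all its induced maps are diagonalizable. -/
def IsSemisimpleDer {n : ℕ} (δ : Der n) : Prop :=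
  ∃ h : δ ∈ singularDer n, ∀ k : ℕ, IsDiagonalizable (inducedMap δ h k)

/-- A singular derivation is topologically nilpotent if all its induced maps are nilpotent. -/
def IsTopNilpotentDer {n : ℕ} (δ : Der n) : Prop :=
  ∃ h : δ ∈ singularDer n, ∀ k : ℕ, IsNilpotent (inducedMap δ h k)

/-- `S` is a minimal generating set of the module `M` (minimal for inclusion). -/
def IsMinimalGenerating {n : ℕ} (M : Submodule (FPS n) (Der n)) (S : Set (Der n)) : Prop :=
  Minimal (fun T : Set (Der n) => Submodule.span (FPS n) T = M) S

/-- The numbers of pairwise commuting semisimple derivations that occur together in some minimal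
generating set of `Der_f`. -/
def commutingSemisimpleCounts {n : ℕ} (f : FPS n) : Set ℕ :=
  {k | ∃ (S : Set (Der n)) (T : Finset (Der n)), IsMinimalGenerating (logDer f) S ∧
    (T : Set (Der n)) ⊆ S ∧ (∀ δ ∈ T, IsSemisimpleDer δ) ∧
    (∀ δ ∈ T, ∀ ε ∈ T, ⁅δ, ε⁆ = 0) ∧ T.card = k}

/-- A formal coordinate system (regular system of parameters) `(y₁, …, yₙ)` together with its
partial derivatives `∂/∂yⱼ`, the unique derivations with `∂yᵢ/∂yⱼ = δᵢⱼ`. -/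
structure FormalCoordinates (n : ℕ) where
  coord : Fin n → FPS n
  span_coord : Ideal.span (Set.range coord) = maximalIdeal (FPS n)
  partialDer : Fin n → Der n
  partialDer_coord : ∀ i j : Fin n, partialDer j (coord i) = if i = j then 1 else 0

end FormalLog

/-! Commuting singular derivations act on the finite-dimensional quotients by powers of the maximal
ideal, and these actions have joint generalized eigenspaces. By completeness, generalized
eigenvectors lift to topological weight vectors (`exists_iInf_genWeight`), and every invariant
submodule of a Noetherian module is spanned modulo the maximal ideal by its weight vectors
(`le_span_weightVec_sup`). With Nakayama, this applies to the maximal ideal (giving coordinates), to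
the ideal of f (giving the unit u), and to `logDer f` under the adjoint action (giving homogeneous
generators).

Weights add under multiplication. Hence any additive functional ψ of the weights defines a
derivation, diagonal in the weight coordinates, that acts on every weight vector by the scalar
ψ(weight): `diagDer_apply_of_isWeightVec`. Evaluation functionals give semisimple parts, and
ℚ-linear functionals ℂ → ℚ give diagonal derivations with rational eigenvalues. All of these are
logarithmic, because uf is a weight vector. A ℚ-linear retraction ℂ → ℚ shows that weights for
rational diagonal derivations are rational.

The hypothesis on f makes elements of 𝔪 · Der_f map into 𝔪², which no nonzero diagonal derivation
does. So linearly independent commuting semisimple elements stay independent modulo 𝔪 · Der_f and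
extend to a minimal generating set. The maximum s is therefore the maximal size of a toral set, at
most n (`mem_commutingSemisimpleCounts_iff`, `IsToral.card_le`).

For a maximal toral set, any commuting semisimple logarithmic derivation lies in its span; this
forces a rational basis (`IsToral.exists_rational`). A homogeneous generator of nonzero weight is
topologically nilpotent, since its powers would otherwise give infinitely many eigenvalues of an
adjoint operator. For one of weight zero, the semisimple part commutes with the torus, hence lies in
its span and can be subtracted (`IsToral.exists_nilpotent_part`). The same argument with the empty
torus settles s = 0. -/

namespace FormalLog

open IsLocalRing

/-! ### Joint generalized eigenspaces modulo a filtration -/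

section Weights

variable {ι X : Type*} [AddCommGroup X] [Module ℂ X]

/-- The vectors that lie, modulo the invariant subspace `F`, in the joint generalized eigenspace
of weight `χ` of the operators `T i`. -/
noncomputable def genWeight (F : Submodule ℂ X) (T : ι → Module.End ℂ X)
    (h : ∀ i, F ≤ F.comap (T i)) (χ : ι → ℂ) : Submodule ℂ X :=
  (⨅ i, Module.End.maxGenEigenspace (F.mapQ F (T i) (h i)) (χ i)).comap F.mkQ

lemma mapQ_sub_smul_pow_apply (F : Submodule ℂ X) (T : Module.End ℂ X)
    (h : F ≤ F.comap T) (c : ℂ) (N : ℕ) (x : X) :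
    ((F.mapQ F T h - c • (1 : Module.End ℂ (X ⧸ F))) ^ N) (F.mkQ x) =
      F.mkQ (((T - c • (1 : Module.End ℂ X)) ^ N) x) := by
  induction N generalizing x with
  | zero => simp
  | succ N ih =>
    rw [pow_succ, pow_succ, Module.End.mul_apply, Module.End.mul_apply, ← ih]
    congr 1

lemma mem_genWeight {F : Submodule ℂ X} {T : ι → Module.End ℂ X}
    {h : ∀ i, F ≤ F.comap (T i)} {χ : ι → ℂ} {x : X} :
    x ∈ genWeight F T h χ ↔
      ∀ i, ∃ N : ℕ, ((T i - χ i • (1 : Module.End ℂ X)) ^ N) x ∈ F := by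
  rw [genWeight, Submodule.mem_comap, Module.End.mem_iInf_maxGenEigenspace_iff]
  refine forall_congr' fun i => exists_congr fun N => ?_
  rw [mapQ_sub_smul_pow_apply, Submodule.mkQ_apply, Submodule.Quotient.mk_eq_zero]

lemma le_genWeight (F : Submodule ℂ X) (T : ι → Module.End ℂ X)
    (h : ∀ i, F ≤ F.comap (T i)) (χ : ι → ℂ) : F ≤ genWeight F T h χ := by
  intro x hx
  exact mem_genWeight.2 fun i => ⟨0, by simpa using hx⟩

lemma genWeight_mono {F G : Submodule ℂ X} (hFG : F ≤ G) {T : ι → Module.End ℂ X}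
    (hF : ∀ i, F ≤ F.comap (T i)) (hG : ∀ i, G ≤ G.comap (T i)) (χ : ι → ℂ) :
    genWeight F T hF χ ≤ genWeight G T hG χ := fun _ hx =>
  mem_genWeight.2 fun i => (mem_genWeight.1 hx i).imp fun _ hN => hFG hN

lemma commute_mapQ {F : Submodule ℂ X} {S T : Module.End ℂ X} (hS : F ≤ F.comap S)
    (hT : F ≤ F.comap T) (h : Commute S T) : Commute (F.mapQ F S hS) (F.mapQ F T hT) := by
  ext x
  have := congrArg F.mkQ (LinearMap.congr_fun h.eq x)
  simpa using this

lemma iSup_genWeight {F : Submodule ℂ X} [FiniteDimensional ℂ (X ⧸ F)]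
    {T : ι → Module.End ℂ X} (h : ∀ i, F ≤ F.comap (T i))
    (hT : ∀ i j, Commute (T i) (T j)) : ⨆ χ, genWeight F T h χ = ⊤ := by
  have key := Module.End.iSup_iInf_maxGenEigenspace_eq_top_of_iSup_maxGenEigenspace_eq_top_of_commute
    (fun i => F.mapQ F (T i) (h i)) (fun i j _ => commute_mapQ (h i) (h j) (hT i j))
    (fun i => Module.End.iSup_maxGenEigenspace_eq_top _)
  have hmap : (⨆ χ, genWeight F T h χ).map F.mkQ = ⊤ := by
    rw [Submodule.map_iSup, ← key]
    exact iSup_congr fun χ => Submodule.map_comap_eq_of_surjective F.mkQ_surjective _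
  -- Every weight space contains `F`, so fullness in the quotient pulls back to fullness in `X`; the
  -- weight 0 is an arbitrary choice.
  have hle : F ≤ ⨆ χ, genWeight F T h χ := (le_genWeight F T h 0).trans (le_iSup _ 0)
  have := congrArg (Submodule.comap F.mkQ) hmap
  rwa [Submodule.comap_map_mkQ, sup_eq_right.2 hle, Submodule.comap_top] at this

lemma genWeight_inf_iSup_le {F : Submodule ℂ X} {T : ι → Module.End ℂ X}
    (h : ∀ i, F ≤ F.comap (T i)) (hT : ∀ i j, Commute (T i) (T j)) (χ : ι → ℂ) :
    genWeight F T h χ ⊓ ⨆ (μ) (_ : μ ≠ χ), genWeight F T h μ ≤ F := by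
  have key := Module.End.independent_iInf_maxGenEigenspace_of_forall_mapsTo
    (fun i => F.mapQ F (T i) (h i)) (fun i j φ => Module.End.mapsTo_maxGenEigenspace_of_comm
      (commute_mapQ (h j) (h i) (hT j i)) φ)
  rintro x ⟨hx, hx'⟩
  have h2 : F.mkQ x ∈ ⨆ (μ) (_ : μ ≠ χ),
      ⨅ i, Module.End.maxGenEigenspace (F.mapQ F (T i) (h i)) (μ i) := by
    have := Submodule.mem_map_of_mem (f := F.mkQ) hx'
    simp only [Submodule.map_iSup] at this
    exact iSup₂_mono (fun μ _ => Submodule.map_comap_le _ _) this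
  have := (Submodule.disjoint_def.1 (key χ)) _ hx h2
  rwa [Submodule.mkQ_apply, Submodule.Quotient.mk_eq_zero] at this

/-- A family of subspaces of the weight spaces that spans everything fills the weight spaces. -/
lemma genWeight_le_of_iSup_eq_top {F : Submodule ℂ X} {T : ι → Module.End ℂ X}
    (h : ∀ i, F ≤ F.comap (T i)) (hT : ∀ i j, Commute (T i) (T j))
    {A : (ι → ℂ) → Submodule ℂ X} (hA : ∀ μ, A μ ≤ genWeight F T h μ)
    (htop : ⨆ μ, A μ = ⊤) (χ : ι → ℂ) : genWeight F T h χ ≤ A χ ⊔ F := by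
  have h1 : A χ ⊔ ⨆ (μ) (_ : μ ≠ χ), A μ = ⊤ := by
    rw [← top_le_iff, ← htop]
    refine iSup_le fun μ => ?_
    by_cases hμ : μ = χ
    · subst hμ; exact le_sup_left
    · exact le_sup_of_le_right (le_iSup₂_of_le μ hμ le_rfl)
  calc genWeight F T h χ = (A χ ⊔ ⨆ (μ) (_ : μ ≠ χ), A μ) ⊓ genWeight F T h χ := by
        rw [h1, top_inf_eq]
    _ = A χ ⊔ (⨆ (μ) (_ : μ ≠ χ), A μ) ⊓ genWeight F T h χ := sup_inf_assoc_of_le _ (hA χ)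
    _ ≤ A χ ⊔ F := by
        refine sup_le_sup_left ?_ _
        rw [inf_comm]
        exact (inf_le_inf_left _ (iSup₂_mono fun μ _ => hA μ)).trans
          (genWeight_inf_iSup_le h hT χ)

variable {F : ℕ → Submodule ℂ X} {T : ι → Module.End ℂ X}

/-- Lifting of joint generalized eigenvectors along a complete filtration. -/
lemma exists_iInf_genWeight (hanti : Antitone F) [∀ k, FiniteDimensional ℂ (X ⧸ F k)]
    (hcomp : ∀ g : ℕ → X, (∀ k, g (k + 1) - g k ∈ F k) → ∃ x, ∀ k, x - g k ∈ F k)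
    (h : ∀ k i, F k ≤ (F k).comap (T i)) (hT : ∀ i j, Commute (T i) (T j))
    (χ : ι → ℂ) (k : ℕ) (x : X) (hx : x ∈ genWeight (F k) T (h k) χ) :
    ∃ y ∈ ⨅ l, genWeight (F l) T (h l) χ, y - x ∈ F k := by
  have lift : ∀ l, ∀ z ∈ genWeight (F l) T (h l) χ,
      ∃ z' ∈ genWeight (F (l + 1)) T (h (l + 1)) χ, z' - z ∈ F l := by
    intro l z hz
    obtain ⟨a, ha, b, hb, rfl⟩ := Submodule.mem_sup.1 <| genWeight_le_of_iSup_eq_top (h l) hT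
      (fun μ => genWeight_mono (hanti l.le_succ) (h (l + 1)) (h l) μ)
      (iSup_genWeight (h (l + 1)) hT) χ hz
    exact ⟨a, ha, by simpa using hb⟩
  choose! φ hφ hφ' using lift
  let g : ℕ → X := fun l => Nat.rec x (fun l z => φ (k + l) z) l
  have hg : ∀ l, g l ∈ genWeight (F (k + l)) T (h (k + l)) χ := by
    intro l
    induction l with
    | zero => exact hx
    | succ l ih => exact hφ _ _ ih
  have hg' : ∀ l, g (l + 1) - g l ∈ F (k + l) := fun l => hφ' _ _ (hg l)
  obtain ⟨y, hy⟩ := hcomp (fun l => g l) fun l => hanti (Nat.le_add_left l k) (hg' l)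
  -- Completeness only controls `y - g l` modulo `F l`; comparing with the later term `g (l + k)`
  -- recovers the shift by `k`.
  have hyl : ∀ l, y - g l ∈ F (k + l) := by
    intro l
    have h3 : ∀ p, g (l + p) - g l ∈ F (k + l) := by
      intro p
      induction p with
      | zero => simp
      | succ p ih =>
        have := add_mem (hanti (by omega : k + l ≤ k + (l + p)) (hg' (l + p))) ih
        simpa [add_assoc] using this
    have := add_mem (hanti (by omega : k + l ≤ l + k) (hy (l + k))) (h3 k)
    simpa using this
  refine ⟨y, (Submodule.mem_iInf _).2 fun l => ?_, hyl 0⟩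
  refine genWeight_mono (hanti (Nat.le_add_left l k)) (h _) (h _) χ ?_
  have := add_mem (le_genWeight _ T (h _) χ (hyl l)) (hg l)
  simpa using this

lemma iSup_iInf_genWeight_sup (hanti : Antitone F) [∀ k, FiniteDimensional ℂ (X ⧸ F k)]
    (hcomp : ∀ g : ℕ → X, (∀ k, g (k + 1) - g k ∈ F k) → ∃ x, ∀ k, x - g k ∈ F k)
    (h : ∀ k i, F k ≤ (F k).comap (T i)) (hT : ∀ i j, Commute (T i) (T j)) (k : ℕ) :
    (⨆ χ, ⨅ l, genWeight (F l) T (h l) χ) ⊔ F k = ⊤ := by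
  rw [← top_le_iff, ← iSup_genWeight (h k) hT]
  refine iSup_le fun χ x hx => ?_
  obtain ⟨y, hy, hyx⟩ := exists_iInf_genWeight hanti hcomp h hT χ k x hx
  refine Submodule.mem_sup.2 ⟨y, (le_iSup (fun χ => ⨅ l, genWeight (F l) T (h l) χ) χ) hy,
    x - y, by simpa using neg_mem hyx, by simp⟩

end Weights

/-! ### The maximal ideal of the power series ring -/

section Ring

variable {n : ℕ}

lemma mem_maximalIdeal_iff {g : FPS n} :
    g ∈ maximalIdeal (FPS n) ↔ MvPowerSeries.constantCoeff g = 0 := by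
  rw [mem_maximalIdeal, mem_nonunits_iff, MvPowerSeries.isUnit_iff_constantCoeff, isUnit_iff_ne_zero,
    not_not]

/-- Split off the monomials divisible by one variable at a time; the remainder is supported on
monomials involving the other variables of `s`. -/
lemma mem_span_X_of_support (s : Finset (Fin n)) (g : FPS n)
    (hg : ∀ d, MvPowerSeries.coeff d g ≠ 0 → ∃ i ∈ s, d i ≠ 0) :
    g ∈ Ideal.span (Set.range (MvPowerSeries.X : Fin n → FPS n)) := by
  induction s using Finset.induction_on generalizing g with
  | empty =>
    have : g = 0 := by
      ext d
      by_contra h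
      obtain ⟨i, hi, -⟩ := hg d h
      simp at hi
    simp [this]
  | insert i s _ ih =>
    classical
    let a : FPS n := fun d => if d i = 0 then 0 else MvPowerSeries.coeff d g
    have ha : ∀ d, MvPowerSeries.coeff d a = if d i = 0 then 0 else MvPowerSeries.coeff d g :=
      fun d => rfl
    have h1 : a ∈ Ideal.span (Set.range (MvPowerSeries.X : Fin n → FPS n)) := by
      have : (MvPowerSeries.X i : FPS n) ∣ a :=
        MvPowerSeries.X_dvd_iff.2 fun d hd => by rw [ha, if_pos hd]
      exact Ideal.mem_of_dvd _ this (Ideal.subset_span ⟨i, rfl⟩)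
    have h2 : g - a ∈ Ideal.span (Set.range (MvPowerSeries.X : Fin n → FPS n)) := by
      refine ih _ fun d hd => ?_
      rw [map_sub, ha] at hd
      split_ifs at hd with h0
      · obtain ⟨j, hj, hj'⟩ := hg d (by simpa using hd)
        rcases Finset.mem_insert.1 hj with rfl | hj
        · exact absurd h0 hj'
        · exact ⟨j, hj, hj'⟩
      · simp at hd
    simpa using add_mem h2 h1

lemma maximalIdeal_eq_span_X :
    maximalIdeal (FPS n) = Ideal.span (Set.range (MvPowerSeries.X : Fin n → FPS n)) := by
  refine le_antisymm (fun g hg => ?_) (Ideal.span_le.2 ?_)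
  · refine mem_span_X_of_support Finset.univ g fun d hd => ?_
    by_contra! h
    have : d = 0 := Finsupp.ext fun i => h i (Finset.mem_univ i)
    subst this
    exact hd (mem_maximalIdeal_iff.1 hg)
  · rintro _ ⟨i, rfl⟩
    exact mem_maximalIdeal_iff.2 (MvPowerSeries.constantCoeff_X i)

instance isAdicComplete_maximalIdeal : IsAdicComplete (maximalIdeal (FPS n)) (FPS n) := by
  rw [maximalIdeal_eq_span_X]
  infer_instance

lemma sub_algebraMap_constantCoeff_mem (g : FPS n) :
    g - algebraMap ℂ (FPS n) (MvPowerSeries.constantCoeff g) ∈ maximalIdeal (FPS n) := by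
  rw [mem_maximalIdeal_iff, map_sub, MvPowerSeries.algebraMap_apply]
  simp

lemma eq_zero_of_forall_mem_pow {g : FPS n} (h : ∀ k, g ∈ maximalIdeal (FPS n) ^ k) : g = 0 :=
  IsHausdorff.haus (I := maximalIdeal (FPS n)) inferInstance g fun k => by
    rw [SModEq.zero, smul_eq_mul, Ideal.mul_top]
    exact h k

end Ring

/-! ### Adic filtration of finite modules: finite-dimensional quotients and completeness -/

section Modules

variable {n : ℕ} {X : Type*} [AddCommGroup X] [Module ℂ X] [Module (FPS n) X]
  [IsScalarTower ℂ (FPS n) X]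

/-- The `𝔪`-adic filtration of a module, by complex subspaces. -/
noncomputable def adicFil (n : ℕ) (X : Type*) [AddCommGroup X] [Module ℂ X] [Module (FPS n) X]
    [IsScalarTower ℂ (FPS n) X] (k : ℕ) : Submodule ℂ X :=
  (maximalIdeal (FPS n) ^ k • (⊤ : Submodule (FPS n) X)).restrictScalars ℂ

lemma mem_adicFil {k : ℕ} {x : X} :
    x ∈ adicFil n X k ↔ x ∈ maximalIdeal (FPS n) ^ k • (⊤ : Submodule (FPS n) X) := Iff.rfl

lemma mem_adicFil_self {k : ℕ} {g : FPS n} :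
    g ∈ adicFil n (FPS n) k ↔ g ∈ maximalIdeal (FPS n) ^ k := by
  rw [mem_adicFil, smul_eq_mul, Ideal.mul_top]

lemma adicFil_antitone : Antitone (adicFil n X) := by
  intro k l h x hx
  rw [mem_adicFil] at hx ⊢
  exact Submodule.smul_mono_left (Ideal.pow_le_pow_right h) hx

/-- Modulo `𝔪`, the power series span of a set is its complex span. -/
lemma mem_span_sup_of_mem_span {S : Set X} {x : X} (hx : x ∈ Submodule.span (FPS n) S) :
    x ∈ Submodule.span ℂ S ⊔
      (maximalIdeal (FPS n) • Submodule.span (FPS n) S).restrictScalars ℂ := by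
  refine Submodule.span_induction (p := fun x _ => x ∈ Submodule.span ℂ S ⊔
      (maximalIdeal (FPS n) • Submodule.span (FPS n) S).restrictScalars ℂ)
    (fun x h => Submodule.mem_sup_left (Submodule.subset_span h)) (zero_mem _)
    (fun x y _ _ hx hy => add_mem hx hy) (fun a x hx ih => ?_) hx
  obtain ⟨b, hb⟩ : ∃ b, b = a - algebraMap ℂ (FPS n) (MvPowerSeries.constantCoeff a) := ⟨_, rfl⟩
  have hb' : b ∈ maximalIdeal (FPS n) := hb ▸ sub_algebraMap_constantCoeff_mem a
  have h1 : a • x = MvPowerSeries.constantCoeff a • x + b • x := by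
    rw [← algebraMap_smul (FPS n) (MvPowerSeries.constantCoeff a) x, ← add_smul, hb,
      add_sub_cancel]
  rw [h1]
  exact add_mem (Submodule.smul_mem _ _ ih) (Submodule.mem_sup_right
    (show b • x ∈ maximalIdeal (FPS n) • Submodule.span (FPS n) S from
      Submodule.smul_mem_smul hb' hx))

lemma exists_fg_sup_adicFil [Module.Finite (FPS n) X] (k : ℕ) :
    ∃ V : Submodule ℂ X, V.FG ∧ V ⊔ adicFil n X k = ⊤ := by
  induction k with
  | zero =>
    refine ⟨⊥, Submodule.fg_bot, top_le_iff.1 fun x _ => Submodule.mem_sup_right ?_⟩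
    rw [mem_adicFil, pow_zero, Ideal.one_eq_top, Submodule.top_smul]
    trivial
  | succ k ih =>
    obtain ⟨V, hV, hV'⟩ := ih
    have : IsNoetherian (FPS n) X := isNoetherian_of_isNoetherianRing_of_finite _ _
    obtain ⟨S, hS⟩ : (maximalIdeal (FPS n) ^ k • (⊤ : Submodule (FPS n) X)).FG :=
      IsNoetherian.noetherian _
    refine ⟨V ⊔ Submodule.span ℂ S, hV.sup ⟨S, rfl⟩, ?_⟩
    rw [← top_le_iff, ← hV', sup_assoc]
    refine sup_le_sup_left (fun x hx => ?_) _
    have h1 : x ∈ Submodule.span (FPS n) (S : Set X) := hS ▸ hx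
    have h2 := mem_span_sup_of_mem_span h1
    have h3 : maximalIdeal (FPS n) • Submodule.span (FPS n) (S : Set X) =
        maximalIdeal (FPS n) ^ (k + 1) • (⊤ : Submodule (FPS n) X) := by
      rw [hS, pow_succ', Submodule.mul_smul]
    rwa [h3] at h2

instance finiteDimensional_quotient_adicFil [Module.Finite (FPS n) X] (k : ℕ) :
    FiniteDimensional ℂ (X ⧸ adicFil n X k) := by
  obtain ⟨V, hV, hV'⟩ := exists_fg_sup_adicFil (n := n) (X := X) k
  rw [FiniteDimensional, Module.finite_def]
  have h1 := hV.map (adicFil n X k).mkQ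
  have h2 : V.map (adicFil n X k).mkQ = ⊤ := by
    have := congrArg (Submodule.map (adicFil n X k).mkQ) hV'
    rwa [Submodule.map_sup, Submodule.mkQ_map_self, sup_bot_eq, Submodule.map_top,
      Submodule.range_mkQ] at this
  rwa [h2] at h1

lemma exists_limit_powerSeries (g : ℕ → FPS n)
    (hg : ∀ k, g (k + 1) - g k ∈ maximalIdeal (FPS n) ^ k) :
    ∃ x, ∀ k, x - g k ∈ maximalIdeal (FPS n) ^ k := by
  have h1 : ∀ {k l}, k ≤ l → g l - g k ∈ maximalIdeal (FPS n) ^ k := by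
    intro k l hkl
    induction l, hkl using Nat.le_induction with
    | base => simp
    | succ l hl ih => simpa using add_mem (Ideal.pow_le_pow_right hl (hg l)) ih
  obtain ⟨x, hx⟩ := IsPrecomplete.prec (I := maximalIdeal (FPS n)) inferInstance (f := g)
    (fun {k l} hkl => by
      rw [SModEq.comm, SModEq.sub_mem, smul_eq_mul, Ideal.mul_top]
      exact h1 hkl)
  refine ⟨x, fun k => ?_⟩
  have := (hx k).symm
  rwa [SModEq.sub_mem, smul_eq_mul, Ideal.mul_top] at this

/-- Write each difference in finitely many generators with coefficients in 𝔪ᵏ and sum the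
coefficients in the complete ring. -/
lemma exists_limit_adicFil [Module.Finite (FPS n) X] (g : ℕ → X)
    (hg : ∀ k, g (k + 1) - g k ∈ adicFil n X k) : ∃ x, ∀ k, x - g k ∈ adicFil n X k := by
  obtain ⟨r, s, hs⟩ := Module.Finite.exists_fin (R := FPS n) (M := X)
  have h1 : ∀ k, ∃ a : Fin r → FPS n, (∀ j, a j ∈ maximalIdeal (FPS n) ^ k) ∧
      ∑ j, a j • s j = g (k + 1) - g k := by
    intro k
    have := hg k
    rw [mem_adicFil, ← hs] at this
    obtain ⟨a, ha, h⟩ := (Submodule.mem_ideal_smul_span_iff_exists_sum _ _ _).1 this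
    refine ⟨a, ha, ?_⟩
    rwa [Finsupp.sum_fintype _ _ (by simp)] at h
  choose a ha has using h1
  have h2 : ∀ j, ∃ b, ∀ k, b - ∑ l ∈ Finset.range k, a l j ∈ maximalIdeal (FPS n) ^ k :=
    fun j => exists_limit_powerSeries _ fun k => by
      rw [Finset.sum_range_succ, add_sub_cancel_left]; exact ha k j
  choose b hb using h2
  refine ⟨g 0 + ∑ j, b j • s j, fun k => ?_⟩
  have h3 : g k = g 0 + ∑ j, (∑ l ∈ Finset.range k, a l j) • s j := by
    simp_rw [Finset.sum_smul]
    rw [Finset.sum_comm]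
    simp_rw [has]
    rw [Finset.sum_range_sub]; abel
  have h4 : g 0 + ∑ j, b j • s j - g k =
      ∑ j, (b j - ∑ l ∈ Finset.range k, a l j) • s j := by
    rw [h3]; simp_rw [sub_smul]; rw [Finset.sum_sub_distrib]; abel
  rw [h4, mem_adicFil]
  exact Submodule.sum_mem _ fun j _ => Submodule.smul_mem_smul (hb j k) trivial

end Modules

/-! ### Continuity of derivations, formal coordinates and diagonal derivations -/

section Derivations

variable {n : ℕ}

lemma der_mem_pow (δ : Der n) (k : ℕ) {g : FPS n} (hg : g ∈ maximalIdeal (FPS n) ^ (k + 1)) :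
    δ g ∈ maximalIdeal (FPS n) ^ k := by
  induction k generalizing g with
  | zero => simp
  | succ k ih =>
    rw [pow_succ] at hg
    refine Submodule.mul_induction_on hg (fun a ha b hb => ?_) fun a b ha hb => ?_
    · rw [Derivation.leibniz, smul_eq_mul, smul_eq_mul, pow_succ]
      refine add_mem (Ideal.mul_mem_right _ _ (by rwa [← pow_succ])) ?_
      rw [mul_comm b]
      exact Ideal.mul_mem_mul (ih ha) hb
    · rw [map_add]
      exact add_mem ha hb

lemma der_mem_pow_of_singular {δ : Der n} (h : δ ∈ singularDer n) {k : ℕ} {g : FPS n}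
    (hg : g ∈ maximalIdeal (FPS n) ^ k) : δ g ∈ maximalIdeal (FPS n) ^ k :=
  maxPow_le_comap h k hg

lemma der_sum_apply {κ : Type*} (s : Finset κ) (D : κ → Der n) (g : FPS n) :
    (∑ i ∈ s, D i) g = ∑ i ∈ s, D i g := by
  classical
  induction s using Finset.induction_on with
  | empty => simp
  | insert i s hi ih => rw [Finset.sum_insert hi, Finset.sum_insert hi, Derivation.add_apply, ih]

variable {y : Fin n → FPS n}

/-- In an expression by products of the `y i`, replacing coefficients by their constant terms costs
one extra order. -/
lemma maximalIdeal_pow_sub_adjoin (hy : Ideal.span (Set.range y) = maximalIdeal (FPS n)) (k : ℕ)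
    {g : FPS n} (hg : g ∈ maximalIdeal (FPS n) ^ k) :
    ∃ p ∈ Algebra.adjoin ℂ (Set.range y), g - p ∈ maximalIdeal (FPS n) ^ (k + 1) := by
  induction k generalizing g with
  | zero =>
    exact ⟨algebraMap ℂ _ (MvPowerSeries.constantCoeff g), Subalgebra.algebraMap_mem _ _,
      by simpa using sub_algebraMap_constantCoeff_mem g⟩
  | succ k ih =>
    rw [pow_succ'] at hg
    nth_rewrite 1 [← hy] at hg
    refine Submodule.mul_induction_on hg (fun a ha b hb => ?_) fun a b ha hb => ?_
    · obtain ⟨c, rfl⟩ := Ideal.mem_span_range_iff_exists_fun.1 ha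
      obtain ⟨p, hp, hbp⟩ := ih hb
      refine ⟨(∑ i, algebraMap ℂ _ (MvPowerSeries.constantCoeff (c i)) * y i) * p,
        mul_mem (sum_mem fun i _ => mul_mem (Subalgebra.algebraMap_mem _ _)
          (Algebra.subset_adjoin ⟨i, rfl⟩)) hp, ?_⟩
      have h1 : (∑ i, c i * y i) * b -
          (∑ i, algebraMap ℂ _ (MvPowerSeries.constantCoeff (c i)) * y i) * p =
          (∑ i, (c i - algebraMap ℂ _ (MvPowerSeries.constantCoeff (c i))) * y i) * b +
          (∑ i, algebraMap ℂ _ (MvPowerSeries.constantCoeff (c i)) * y i) * (b - p) := by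
        simp_rw [sub_mul]
        rw [Finset.sum_sub_distrib]
        ring
      have hym : ∀ i, y i ∈ maximalIdeal (FPS n) := fun i => hy ▸ Ideal.subset_span ⟨i, rfl⟩
      rw [h1]
      refine add_mem ?_ ?_
      · rw [show k + 1 + 1 = 2 + k by ring, pow_add, pow_two]
        exact Ideal.mul_mem_mul (sum_mem fun i _ =>
          Ideal.mul_mem_mul (sub_algebraMap_constantCoeff_mem _) (hym i)) hb
      · rw [show k + 1 + 1 = 1 + (k + 1) by ring, pow_add, pow_one]
        exact Ideal.mul_mem_mul (sum_mem fun i _ => Ideal.mul_mem_left _ _ (hym i)) hbp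
    · obtain ⟨p, hp, hp'⟩ := ha
      obtain ⟨q, hq, hq'⟩ := hb
      exact ⟨p + q, add_mem hp hq, by rw [add_sub_add_comm]; exact add_mem hp' hq'⟩

lemma exists_adjoin_sub_mem (hy : Ideal.span (Set.range y) = maximalIdeal (FPS n)) (k : ℕ)
    (g : FPS n) : ∃ p ∈ Algebra.adjoin ℂ (Set.range y), g - p ∈ maximalIdeal (FPS n) ^ k := by
  induction k with
  | zero => exact ⟨0, zero_mem _, by simp⟩
  | succ k ih =>
    obtain ⟨p, hp, hgp⟩ := ih
    obtain ⟨q, hq, hgq⟩ := maximalIdeal_pow_sub_adjoin hy k hgp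
    exact ⟨p + q, add_mem hp hq, by rwa [← sub_sub]⟩

/-- The derivation kills the polynomials in `y`, which are dense, and it is continuous because it
lowers the order by at most one. -/
lemma der_eq_zero (hy : Ideal.span (Set.range y) = maximalIdeal (FPS n)) {δ : Der n}
    (h : ∀ j, δ (y j) = 0) : δ = 0 := by
  have h0 : ∀ p ∈ Algebra.adjoin ℂ (Set.range y), δ p = 0 := by
    intro p hp
    induction hp using Algebra.adjoin_induction with
    | mem x hx => obtain ⟨j, rfl⟩ := hx; exact h j
    | algebraMap r => simp
    | add a b _ _ ha hb => rw [map_add, ha, hb, add_zero]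
    | mul a b _ _ ha hb => rw [Derivation.leibniz, ha, hb, smul_zero, smul_zero, add_zero]
  ext1 g
  refine eq_zero_of_forall_mem_pow fun k => ?_
  obtain ⟨p, hp, hgp⟩ := exists_adjoin_sub_mem hy (k + 1) g
  have := der_mem_pow δ k hgp
  rwa [map_sub, h0 p hp, sub_zero] at this

lemma der_ext (hy : Ideal.span (Set.range y) = maximalIdeal (FPS n)) {δ ε : Der n}
    (h : ∀ j, δ (y j) = ε (y j)) : δ = ε :=
  sub_eq_zero.1 <| der_eq_zero hy fun j => by rw [Derivation.sub_apply, h j, sub_self]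

instance finite_der : Module.Finite (FPS n) (Der n) := by
  let φ : Der n →ₗ[FPS n] (Fin n → FPS n) :=
    { toFun := fun δ j => δ (MvPowerSeries.X j)
      map_add' := fun a b => by ext1 j; simp
      map_smul' := fun a b => by ext1 j; simp }
  refine Module.Finite.of_injective φ fun δ ε h => ?_
  exact der_ext maximalIdeal_eq_span_X.symm fun j => congrFun h j

instance isNoetherian_der : IsNoetherian (FPS n) (Der n) :=
  isNoetherian_of_isNoetherianRing_of_finite _ _

lemma exists_formalCoordinates (hy : Ideal.span (Set.range y) = maximalIdeal (FPS n)) :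
    ∃ Y : FormalCoordinates n, Y.coord = y := by
  have hym : ∀ i, y i ∈ maximalIdeal (FPS n) := fun i => hy ▸ Ideal.subset_span ⟨i, rfl⟩
  have hXm : ∀ i, (MvPowerSeries.X i : FPS n) ∈ maximalIdeal (FPS n) :=
    fun i => maximalIdeal_eq_span_X.symm ▸ Ideal.subset_span ⟨i, rfl⟩
  have h1 : ∀ i, ∃ c : Fin n → FPS n, ∑ j, c j * y j = MvPowerSeries.X i := fun i =>
    Ideal.mem_span_range_iff_exists_fun.1 (hy.symm ▸ hXm i)
  choose b hb using h1
  let J : Matrix (Fin n) (Fin n) (FPS n) := Matrix.of fun i j => MvPowerSeries.pderiv ℂ j (y i)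
  let B : Matrix (Fin n) (Fin n) (FPS n) := Matrix.of b
  let ρ := (MvPowerSeries.constantCoeff : FPS n →+* ℂ)
  -- Differentiate `X i = ∑ b i j * y j` and take constant terms: the Leibniz terms containing `y j`
  -- vanish. So the Jacobian `J` is invertible, and its inverse supplies the dual partial
  -- derivatives.
  have hBJ : ρ.mapMatrix (B * J) = 1 := by
    ext i k
    have h2 := congrArg (fun g => ρ (MvPowerSeries.pderiv ℂ k g)) (hb i)
    simp only [map_sum, Derivation.leibniz, map_add, smul_eq_mul, map_mul] at h2
    have h3 : ∀ j, ρ (y j) = 0 := fun j => mem_maximalIdeal_iff.1 (hym j)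
    simp only [h3, zero_mul, add_zero, MvPowerSeries.pderiv_X] at h2
    simp only [RingHom.mapMatrix_apply, Matrix.map_apply, Matrix.mul_apply, map_mul,
      Matrix.of_apply, B, J, Matrix.one_apply]
    rw [h2]
    split_ifs <;> simp_all [eq_comm]
  have hdet : IsUnit J.det := by
    rw [MvPowerSeries.isUnit_iff_constantCoeff]
    have h4 := congrArg Matrix.det hBJ
    rw [← RingHom.map_det, Matrix.det_mul, map_mul, Matrix.det_one] at h4
    exact IsUnit.of_mul_eq_one _ ((mul_comm _ _).trans h4)
  refine ⟨⟨y, hy, fun j => ∑ k, J⁻¹ k j • MvPowerSeries.pderiv ℂ k, fun i j => ?_⟩, rfl⟩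
  have h5 := congrFun (congrFun (Matrix.mul_nonsing_inv J hdet) i) j
  rw [Matrix.mul_apply, Matrix.one_apply] at h5
  rw [← h5, der_sum_apply]
  refine Finset.sum_congr rfl fun k _ => ?_
  simp [J, mul_comm]

variable (Y : FormalCoordinates n)

namespace FormalCoordinates

lemma coord_mem (j : Fin n) : Y.coord j ∈ maximalIdeal (FPS n) :=
  Y.span_coord ▸ Ideal.subset_span ⟨j, rfl⟩

/-- The derivation which is diagonal, with eigenvalues `w`, in the given coordinates. -/
noncomputable def diagDer (w : Fin n → ℂ) : Der n :=
  ∑ j, w j • (Y.coord j • Y.partialDer j)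

@[simp]
lemma diagDer_coord (w : Fin n → ℂ) (i : Fin n) : Y.diagDer w (Y.coord i) = w i • Y.coord i := by
  rw [diagDer, der_sum_apply]
  simp [Y.partialDer_coord]

lemma diagDer_add (v w : Fin n → ℂ) : Y.diagDer (v + w) = Y.diagDer v + Y.diagDer w := by
  simp [diagDer, add_smul, Finset.sum_add_distrib]

lemma diagDer_smul (c : ℂ) (w : Fin n → ℂ) : Y.diagDer (c • w) = c • Y.diagDer w := by
  simp [diagDer, Finset.smul_sum, mul_smul]

lemma eq_sum (δ : Der n) : δ = ∑ j, δ (Y.coord j) • Y.partialDer j := by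
  refine der_ext Y.span_coord fun i => ?_
  rw [der_sum_apply]
  simp [Y.partialDer_coord]

lemma mem_singularDer {δ : Der n} (h : ∀ j, δ (Y.coord j) ∈ maximalIdeal (FPS n)) :
    δ ∈ singularDer n := by
  rw [Y.eq_sum δ]
  exact Submodule.sum_mem _ fun j _ => Submodule.smul_mem_smul (h j) trivial

lemma diagDer_mem_singularDer (w : Fin n → ℂ) : Y.diagDer w ∈ singularDer n :=
  Y.mem_singularDer fun j => by
    rw [diagDer_coord, Algebra.smul_def]
    exact Ideal.mul_mem_left _ _ (Y.coord_mem j)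

lemma lie_diagDer (v w : Fin n → ℂ) : ⁅Y.diagDer v, Y.diagDer w⁆ = 0 := by
  refine der_eq_zero Y.span_coord fun i => ?_
  rw [Derivation.commutator_apply]
  simp [smul_smul, mul_comm]

/-- A coordinate function does not lie in `𝔪 ^ 2`. -/
lemma coord_notMem_sq (j : Fin n) : Y.coord j ∉ maximalIdeal (FPS n) ^ 2 := by
  intro h
  have h1 := der_mem_pow (Y.partialDer j) 1 h
  rw [Y.partialDer_coord, if_pos rfl, pow_one] at h1
  exact (Ideal.ne_top_iff_one _).1 (maximalIdeal.isMaximal _).ne_top h1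

end FormalCoordinates

end Derivations

/-! ### Additivity of weights under pairings -/

section Leibniz

variable {A B C : Type*} [AddCommGroup A] [Module ℂ A] [AddCommGroup B] [Module ℂ B]
  [AddCommGroup C] [Module ℂ C]

/-- Generalized eigenvectors are multiplicative for pairings that satisfy the Leibniz rule. -/
lemma leibniz_pow_mem (β : A →ₗ[ℂ] B →ₗ[ℂ] C) (S : Module.End ℂ A) (T : Module.End ℂ B)
    (U : Module.End ℂ C) (hβ : ∀ a b, U (β a b) = β (S a) b + β a (T b))
    {FA : Submodule ℂ A} {FB : Submodule ℂ B} {FC : Submodule ℂ C} (hU : FC ≤ FC.comap U)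
    (hA : ∀ a ∈ FA, ∀ b, β a b ∈ FC) (hB : ∀ a, ∀ b ∈ FB, β a b ∈ FC) {c d : ℂ} (p q : ℕ)
    {a : A} {b : B} (ha : ((S - c • (1 : Module.End ℂ A)) ^ p) a ∈ FA)
    (hb : ((T - d • (1 : Module.End ℂ B)) ^ q) b ∈ FB) :
    ((U - (c + d) • (1 : Module.End ℂ C)) ^ (p + q)) (β a b) ∈ FC := by
  have inv : ∀ N x, x ∈ FC → ((U - (c + d) • (1 : Module.End ℂ C)) ^ N) x ∈ FC := by
    intro N
    induction N with
    | zero => intro x hx; simpa using hx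
    | succ N ih =>
      intro x hx
      rw [pow_succ, Module.End.mul_apply]
      refine ih _ ?_
      simpa using sub_mem (show U x ∈ FC from hU hx) (FC.smul_mem (c + d) hx)
  -- Induct on `p + q`: one application of `U - (c + d)` splits into two terms, each lowering one
  -- exponent; once an exponent is 0 the pairing already lies in `FC`.
  obtain ⟨N, hN⟩ : ∃ N, N = p + q := ⟨_, rfl⟩
  rw [← hN]
  induction N generalizing p q a b with
  | zero =>
    obtain rfl : p = 0 := by omega
    simpa using hA _ (by simpa using ha) b
  | succ N ih =>
    rcases p with _ | p
    · exact inv _ _ (hA _ (by simpa using ha) b)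
    rcases q with _ | q
    · exact inv _ _ (hB _ _ (by simpa using hb))
    have h1 : (U - (c + d) • (1 : Module.End ℂ C)) (β a b) =
        β ((S - c • (1 : Module.End ℂ A)) a) b + β a ((T - d • (1 : Module.End ℂ B)) b) := by
      change U (β a b) - (c + d) • β a b = β (S a - c • a) b + β a (T b - d • b)
      simp only [LinearMap.sub_apply, LinearMap.smul_apply, hβ, map_sub, map_smul, add_smul]
      abel
    rw [pow_succ, Module.End.mul_apply, h1, map_add]
    rw [pow_succ, Module.End.mul_apply] at ha hb
    refine add_mem (ih p (q + 1) ha ?_ (by omega)) (ih (p + 1) q ?_ hb (by omega))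
    · rwa [pow_succ, Module.End.mul_apply]
    · rwa [pow_succ, Module.End.mul_apply]

end Leibniz

/-! ### Topological weight vectors in modules -/

section WeightVectors

variable {n : ℕ} {ι : Type*} {X : Type*} [AddCommGroup X] [Module ℂ X] [Module (FPS n) X]
  [IsScalarTower ℂ (FPS n) X]

/-- A topological joint generalized eigenvector of weight `χ`. -/
def IsWeightVec (n : ℕ) {X : Type*} [AddCommGroup X] [Module ℂ X] [Module (FPS n) X]
    [IsScalarTower ℂ (FPS n) X] (T : ι → Module.End ℂ X) (χ : ι → ℂ) (x : X) : Prop :=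
  ∀ k i, ∃ N : ℕ, ((T i - χ i • (1 : Module.End ℂ X)) ^ N) x ∈ adicFil n X k

/-- The Leibniz rule over a singular `δ` covers both uses: `T = δ` on power series and `T = ad δ` on
derivations. -/
lemma adicFil_le_comap {δ : Der n} (hδ : δ ∈ singularDer n) {T : Module.End ℂ X}
    (hT : ∀ (a : FPS n) x, T (a • x) = δ a • x + a • T x) (k : ℕ) :
    adicFil n X k ≤ (adicFil n X k).comap T := by
  intro x hx
  rw [mem_adicFil] at hx
  rw [Submodule.mem_comap, mem_adicFil]
  refine Submodule.smul_induction_on hx (fun a ha x _ => ?_) fun x y hx hy => ?_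
  · rw [hT]
    exact add_mem (Submodule.smul_mem_smul (der_mem_pow_of_singular hδ ha) trivial)
      (Submodule.smul_mem_smul ha trivial)
  · rw [map_add]
    exact add_mem hx hy

lemma span_weightVec_sup [Module.Finite (FPS n) X] {δ : ι → Der n}
    (hδ : ∀ i, δ i ∈ singularDer n) {T : ι → Module.End ℂ X}
    (hT : ∀ i (a : FPS n) x, T i (a • x) = δ i a • x + a • T i x)
    (hcomm : ∀ i j, Commute (T i) (T j)) (k : ℕ) :
    Submodule.span ℂ {x | ∃ χ, IsWeightVec n T χ x} ⊔ adicFil n X k = ⊤ := by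
  rw [← top_le_iff, ← iSup_iInf_genWeight_sup adicFil_antitone exists_limit_adicFil
    (fun k i => adicFil_le_comap (hδ i) (hT i) k) hcomm k]
  refine sup_le_sup_right (iSup_le fun χ x hx => Submodule.subset_span ?_) _
  refine ⟨χ, fun l i => ?_⟩
  exact mem_genWeight.1 ((Submodule.mem_iInf _).1 hx l) i

/-- An invariant submodule is spanned, modulo `𝔪`, by the weight vectors it contains. -/
lemma le_span_weightVec_sup [IsNoetherian (FPS n) X] (P : Submodule (FPS n) X)
    {δ : ι → Der n} (hδ : ∀ i, δ i ∈ singularDer n) {S : ι → Module.End ℂ X}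
    (hS : ∀ i (a : FPS n) x, S i (a • x) = δ i a • x + a • S i x)
    (hcomm : ∀ i j, Commute (S i) (S j)) (hP : ∀ i, ∀ x ∈ P, S i x ∈ P) :
    P.restrictScalars ℂ ≤ Submodule.span ℂ {x | x ∈ P ∧ ∃ χ, IsWeightVec n S χ x} ⊔
      (maximalIdeal (FPS n) • P).restrictScalars ℂ := by
  -- Work in `P` with its own adic filtration, so that the error term lies in 𝔪P and not merely in
  -- 𝔪X ∩ P.
  let T : ι → Module.End ℂ P := fun i =>
    { toFun := fun x => ⟨S i x, hP i x x.2⟩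
      map_add' := fun x y => Subtype.ext (by simp)
      map_smul' := fun c x => Subtype.ext (by simp) }
  let e : P →ₗ[ℂ] X := P.subtype.restrictScalars ℂ
  have hTS : ∀ (i : ι) (c : ℂ) (N : ℕ) (x : P), e (((T i - c • (1 : Module.End ℂ P)) ^ N) x) =
      ((S i - c • (1 : Module.End ℂ X)) ^ N) (e x) := by
    intro i c N
    induction N with
    | zero => intro x; simp
    | succ N ih =>
      intro x
      rw [pow_succ, pow_succ, Module.End.mul_apply, Module.End.mul_apply, ih]
      congr 1
  have hfil : ∀ k (x : P), x ∈ adicFil n P k → e x ∈ maximalIdeal (FPS n) ^ k • P := by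
    intro k x hx
    have := Submodule.mem_map_of_mem (f := P.subtype) (mem_adicFil.1 hx)
    rwa [Submodule.map_smul'', Submodule.map_top, Submodule.range_subtype] at this
  have htop := span_weightVec_sup (X := P) hδ (T := T)
    (fun i a x => Subtype.ext (by simpa [T] using hS i a x))
    (fun i j => LinearMap.ext fun x => Subtype.ext (LinearMap.congr_fun (hcomm i j) x)) 1
  intro x hx
  obtain ⟨v, hv, z, hz, hvz⟩ := Submodule.mem_sup.1
    (htop.symm ▸ Submodule.mem_top : (⟨x, hx⟩ : P) ∈ _)
  refine Submodule.mem_sup.2 ⟨e v, ?_, e z, ?_, congrArg e hvz⟩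
  · refine (Submodule.map_span_le e _ _).2 ?_ (Submodule.mem_map_of_mem hv)
    rintro p ⟨χ, hp⟩
    refine Submodule.subset_span ⟨p.2, χ, fun k i => ?_⟩
    obtain ⟨N, hN⟩ := hp k i
    refine ⟨N, ?_⟩
    have := hfil k _ hN
    rw [hTS] at this
    have hle : maximalIdeal (FPS n) ^ k • P ≤ maximalIdeal (FPS n) ^ k • ⊤ :=
      Submodule.smul_mono le_rfl le_top
    exact mem_adicFil.2 (hle this)
  · simpa using hfil 1 z hz

end WeightVectors

/-! ### Additive functionals of weights as diagonal derivations -/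

section PowerSeries

variable {n : ℕ} {ι : Type*}

/-- The underlying operators of a family of derivations. -/
def opFamily (δ : ι → Der n) (i : ι) : Module.End ℂ (FPS n) := (δ i : FPS n →ₗ[ℂ] FPS n)

lemma opFamily_apply (δ : ι → Der n) (i : ι) (g : FPS n) : opFamily δ i g = δ i g := rfl

lemma opFamily_leibniz (δ : ι → Der n) (i : ι) (a x : FPS n) :
    opFamily δ i (a • x) = δ i a • x + a • opFamily δ i x := by
  simp only [opFamily_apply, smul_eq_mul, Derivation.leibniz]
  ring

lemma commute_opFamily {δ : ι → Der n} (hcomm : ∀ i j, ⁅δ i, δ j⁆ = 0) (i j : ι) :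
    Commute (opFamily δ i) (opFamily δ j) := by
  refine LinearMap.ext fun x => ?_
  have := congrArg (fun D : Der n => D x) (hcomm i j)
  simpa [Derivation.commutator_apply, sub_eq_zero, opFamily] using this

lemma opFamily_le_comap {δ : ι → Der n} (hδ : ∀ i, δ i ∈ singularDer n) (k : ℕ) (i : ι) :
    adicFil n (FPS n) k ≤ (adicFil n (FPS n) k).comap (opFamily δ i) :=
  adicFil_le_comap (hδ i) (opFamily_leibniz δ i) k

/-- If the coordinates are weight vectors for a commuting family of derivations, then an additive
function of the weight acts on weight vectors as the corresponding diagonal derivation. -/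
lemma diagDer_apply_of_isWeightVec {δ : ι → Der n} (hδ : ∀ i, δ i ∈ singularDer n)
    (hcomm : ∀ i j, ⁅δ i, δ j⁆ = 0) (Y : FormalCoordinates n) {Λ : Fin n → ι → ℂ}
    (hY : ∀ j, IsWeightVec n (opFamily δ) (Λ j) (Y.coord j)) (ψ : (ι → ℂ) →+ ℂ)
    {χ : ι → ℂ} {h : FPS n} (hh : IsWeightVec n (opFamily δ) χ h) :
    Y.diagDer (fun j => ψ (Λ j)) h = ψ χ • h := by
  obtain ⟨D, hD⟩ : ∃ D, D = Y.diagDer (fun j => ψ (Λ j)) := ⟨_, rfl⟩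
  have hDs : D ∈ singularDer n := hD ▸ Y.diagDer_mem_singularDer _
  have hDc : ∀ j, D (Y.coord j) = ψ (Λ j) • Y.coord j := fun j => hD ▸ Y.diagDer_coord _ j
  rw [← hD]
  refine sub_eq_zero.1 (eq_zero_of_forall_mem_pow fun k => ?_)
  obtain ⟨F, hF⟩ : ∃ F, F = adicFil n (FPS n) k := ⟨_, rfl⟩
  have hFm : ∀ g, g ∈ F ↔ g ∈ maximalIdeal (FPS n) ^ k := fun g => hF ▸ mem_adicFil_self
  have hFc : ∀ i, F ≤ F.comap (opFamily δ i) := hF ▸ opFamily_le_comap hδ k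
  have hFl : ∀ a ∈ F, ∀ b, LinearMap.mul ℂ (FPS n) a b ∈ F := fun a ha b =>
    (hFm _).2 (Ideal.mul_mem_right _ _ ((hFm _).1 ha))
  have hFr : ∀ a, ∀ b ∈ F, LinearMap.mul ℂ (FPS n) a b ∈ F := fun a b hb =>
    (hFm _).2 (Ideal.mul_mem_left _ _ ((hFm _).1 hb))
  have hDF : ∀ g ∈ F, D g ∈ F := fun g hg =>
    (hFm _).2 (der_mem_pow_of_singular hDs ((hFm _).1 hg))
  -- `B μ` is the part of the weight space where `D` acts by `ψ μ` modulo `F`. These spaces multiply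
  -- additively in `μ` and contain the coordinates, so they span everything and must exhaust the
  -- weight spaces.
  let B : (ι → ℂ) → Submodule ℂ (FPS n) := fun μ => genWeight F (opFamily δ) hFc μ ⊓
    F.comap ((D : FPS n →ₗ[ℂ] FPS n) - ψ μ • (1 : Module.End ℂ (FPS n)))
  have hB : ∀ μ g, g ∈ B μ ↔ g ∈ genWeight F (opFamily δ) hFc μ ∧ D g - ψ μ • g ∈ F :=
    fun μ g => Iff.rfl
  have hFB : ∀ μ, F ≤ B μ := fun μ g hg =>
    (hB _ _).2 ⟨le_genWeight _ _ _ _ hg, sub_mem (hDF g hg) (F.smul_mem _ hg)⟩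
  have hmul : ∀ μ ν a b, a ∈ B μ → b ∈ B ν → a * b ∈ B (μ + ν) := by
    intro μ ν a b ha hb
    rw [hB] at ha hb ⊢
    refine ⟨mem_genWeight.2 fun i => ?_, ?_⟩
    · obtain ⟨p, hp⟩ := mem_genWeight.1 ha.1 i
      obtain ⟨q, hq⟩ := mem_genWeight.1 hb.1 i
      exact ⟨p + q, leibniz_pow_mem (LinearMap.mul ℂ (FPS n)) _ _ (opFamily δ i)
        (fun a b => by
          simp only [LinearMap.mul_apply', opFamily_apply, Derivation.leibniz, smul_eq_mul]; ring)
        (hFc i) hFl hFr p q hp hq⟩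
    · have h1 : D (a * b) - ψ (μ + ν) • (a * b) =
          LinearMap.mul ℂ (FPS n) a (D b - ψ ν • b) +
          LinearMap.mul ℂ (FPS n) (D a - ψ μ • a) b := by
        rw [Derivation.leibniz, map_add, add_smul]
        simp only [LinearMap.mul_apply', smul_eq_mul, mul_sub, sub_mul, mul_smul_comm,
          smul_mul_assoc]
        ring
      rw [h1]
      exact add_mem (hFr _ _ hb.2) (hFl _ ha.2 _)
  have hone : (1 : FPS n) ∈ B 0 := by
    refine (hB _ _).2 ⟨mem_genWeight.2 fun i => ⟨1, ?_⟩, ?_⟩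
    · simp [opFamily_apply]
    · simp
  have hadj : ∀ p ∈ Algebra.adjoin ℂ (Set.range Y.coord), p ∈ ⨆ μ, B μ := by
    intro p hp
    induction hp using Algebra.adjoin_induction with
    | mem x hx =>
      obtain ⟨j, rfl⟩ := hx
      refine Submodule.mem_iSup_of_mem (Λ j) ((hB _ _).2 ⟨mem_genWeight.2 fun i => ?_, ?_⟩)
      · rw [hF]; exact hY j k i
      · rw [hDc, sub_self]; exact zero_mem _
    | algebraMap r =>
      rw [Algebra.algebraMap_eq_smul_one]
      exact Submodule.smul_mem _ _ (Submodule.mem_iSup_of_mem 0 hone)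
    | add a b _ _ ha hb => exact add_mem ha hb
    | mul a b _ _ ha hb =>
      have := Submodule.mul_mem_mul ha hb
      rw [Submodule.iSup_mul] at this
      refine (iSup_le fun μ => ?_ : _ ≤ ⨆ μ, B μ) this
      rw [Submodule.mul_iSup]
      refine iSup_le fun ν => (Submodule.mul_le.2 fun a ha b hb => ?_)
      exact Submodule.mem_iSup_of_mem (μ + ν) (hmul μ ν a b ha hb)
  have htop : ⨆ μ, B μ = ⊤ := by
    refine top_le_iff.1 fun g _ => ?_
    obtain ⟨p, hp, hgp⟩ := exists_adjoin_sub_mem Y.span_coord k g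
    rw [← sub_add_cancel g p]
    exact add_mem (Submodule.mem_iSup_of_mem 0 (hFB 0 ((hFm _).2 hgp))) (hadj p hp)
  have h2 := genWeight_le_of_iSup_eq_top hFc (commute_opFamily hcomm) (A := B)
    (fun μ => inf_le_left) htop χ
  have h3 : h ∈ genWeight F (opFamily δ) hFc χ := mem_genWeight.2 fun i => by
    rw [hF]; exact hh k i
  have h4 : h ∈ B χ := by
    have := h2 h3
    rwa [sup_eq_left.2 (hFB χ)] at this
  exact (hFm _).1 ((hB _ _).1 h4).2

end PowerSeries

/-! ### Weight coordinates, weight generators of principal ideals, induced maps -/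

section Diagonalization

variable {n : ℕ} {ι : Type*}

/-- The linear part of a power series. -/
noncomputable def linearPart (n : ℕ) : FPS n →ₗ[ℂ] (Fin n → ℂ) where
  toFun g i := MvPowerSeries.constantCoeff (MvPowerSeries.pderiv ℂ i g)
  map_add' a b := by ext i; simp
  map_smul' c a := by ext i; simp [MvPowerSeries.smul_eq_C_mul]

lemma linearPart_apply (g : FPS n) (i : Fin n) :
    linearPart n g i = MvPowerSeries.constantCoeff (MvPowerSeries.pderiv ℂ i g) := rfl

lemma linearPart_eq_zero_iff {g : FPS n} (hg : g ∈ maximalIdeal (FPS n)) :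
    linearPart n g = 0 ↔ g ∈ maximalIdeal (FPS n) • maximalIdeal (FPS n) := by
  refine ⟨fun h => ?_, fun h => ?_⟩
  · rw [maximalIdeal_eq_span_X] at hg
    obtain ⟨a, rfl⟩ := Ideal.mem_span_range_iff_exists_fun.1 hg
    refine sum_mem fun i _ => Submodule.smul_mem_smul ?_
      (maximalIdeal_eq_span_X.symm ▸ Ideal.subset_span ⟨i, rfl⟩)
    have h1 := congrFun h i
    simp only [linearPart_apply, map_sum, Derivation.leibniz, map_add, smul_eq_mul, map_mul,
      MvPowerSeries.constantCoeff_X, zero_mul, add_zero, MvPowerSeries.pderiv_X] at h1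
    rw [Finset.sum_eq_single i (fun j _ hj => by simp [hj.symm]) (by simp)] at h1
    exact mem_maximalIdeal_iff.2 (by simpa using h1)
  · ext i
    rw [smul_eq_mul, ← pow_two] at h
    have := der_mem_pow (MvPowerSeries.pderiv ℂ i) 1 h
    rw [pow_one] at this
    exact mem_maximalIdeal_iff.1 this

/-- A set spanning `𝔪` modulo `𝔪 ^ 2` contains a coordinate system. -/
lemma exists_formalCoordinates_of_span {E : Set (FPS n)}
    (hE : ∀ x ∈ E, x ∈ maximalIdeal (FPS n))
    (hspan : (maximalIdeal (FPS n)).restrictScalars ℂ ≤ Submodule.span ℂ E ⊔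
      (maximalIdeal (FPS n) • maximalIdeal (FPS n)).restrictScalars ℂ) :
    ∃ Y : FormalCoordinates n, ∀ j, Y.coord j ∈ E := by
  obtain ⟨b, hbE, -, hb, hli⟩ := exists_linearIndepOn_extension
    (linearIndepOn_empty ℂ (linearPart n)) (Set.empty_subset E)
  have hmap : ∀ x ∈ maximalIdeal (FPS n), linearPart n x ∈
      Submodule.span ℂ (Set.range fun x : b => linearPart n x) := by
    intro x hx
    obtain ⟨v, hv, z, hz, rfl⟩ := Submodule.mem_sup.1 (hspan hx)
    have hz' : z ∈ maximalIdeal (FPS n) := Ideal.mul_le_left hz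
    rw [map_add, (linearPart_eq_zero_iff hz').2 hz, add_zero]
    have h2 := Submodule.mem_map_of_mem (f := linearPart n) hv
    rw [Submodule.map_span] at h2
    have h3 := Submodule.span_le.2 hb h2
    rwa [Set.image_eq_range] at h3
  have htop : ⊤ ≤ Submodule.span ℂ (Set.range fun x : b => linearPart n x) := by
    rw [← (Pi.basisFun ℂ (Fin n)).span_eq, Submodule.span_le]
    rintro _ ⟨i, rfl⟩
    have h4 : linearPart n (MvPowerSeries.X i) = Pi.basisFun ℂ (Fin n) i := by
      ext j
      rw [linearPart_apply, MvPowerSeries.pderiv_X, Pi.basisFun_apply]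
      by_cases h : i = j
      · subst h; simp
      · simp [h, Ne.symm h]
    rw [SetLike.mem_coe, ← h4]
    exact hmap _ (mem_maximalIdeal_iff.2 (MvPowerSeries.constantCoeff_X i))
  let B := Module.Basis.mk (v := fun x : b => linearPart n x) hli htop
  let e : b ≃ Fin n := B.indexEquiv (Pi.basisFun ℂ (Fin n))
  let y : Fin n → FPS n := fun j => (e.symm j : FPS n)
  have hyE : ∀ j, y j ∈ E := fun j => hbE (e.symm j).2
  have hyB : ∀ j, (B.reindex e) j = linearPart n (y j) := fun j => by
    rw [B.reindex_apply]
    exact Module.Basis.mk_apply hli htop _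
  have hle : maximalIdeal (FPS n) ≤ Ideal.span (Set.range y) := by
    refine Submodule.le_of_le_smul_of_le_jacobson_bot (IsNoetherian.noetherian _)
      (maximalIdeal_le_jacobson _) fun g hg => ?_
    have h5 := (B.reindex e).sum_repr (linearPart n g)
    obtain ⟨c, hc⟩ : ∃ c : Fin n → ℂ, c = (B.reindex e).repr (linearPart n g) := ⟨_, rfl⟩
    simp only [← hc, hyB] at h5
    refine Submodule.mem_sup.2 ⟨∑ j, c j • y j, ?_, g - ∑ j, c j • y j, ?_, by simp⟩
    · refine sum_mem fun j _ => ?_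
      rw [Algebra.smul_def]
      exact Ideal.mul_mem_left _ _ (Ideal.subset_span ⟨j, rfl⟩)
    · refine (linearPart_eq_zero_iff (sub_mem hg (sum_mem fun j _ => ?_))).1 ?_
      · rw [Algebra.smul_def]
        exact Ideal.mul_mem_left _ _ (hE _ (hyE j))
      · simp [h5]
  have hge : Ideal.span (Set.range y) ≤ maximalIdeal (FPS n) := by
    rw [Ideal.span_le]
    rintro _ ⟨j, rfl⟩
    exact hE _ (hyE j)
  obtain ⟨Y, hY⟩ := exists_formalCoordinates (le_antisymm hge hle)
  exact ⟨Y, fun j => hY ▸ hyE j⟩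

/-- Coordinates consisting of joint generalized eigenvectors of commuting derivations. -/
lemma exists_weight_coordinates {δ : ι → Der n} (hδ : ∀ i, δ i ∈ singularDer n)
    (hcomm : ∀ i j, ⁅δ i, δ j⁆ = 0) :
    ∃ (Y : FormalCoordinates n) (Λ : Fin n → ι → ℂ),
      ∀ j, IsWeightVec n (opFamily δ) (Λ j) (Y.coord j) := by
  have h1 := le_span_weightVec_sup (maximalIdeal (FPS n)) hδ (opFamily_leibniz δ)
    (commute_opFamily hcomm) (fun i x _ => apply_mem_maximalIdeal (hδ i) x)
  obtain ⟨Y, hY⟩ := exists_formalCoordinates_of_span (fun x hx => hx.1) h1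
  choose Λ hΛ using fun j => (hY j).2
  exact ⟨Y, Λ, hΛ⟩

lemma isWeightVec_zero {X : Type*} [AddCommGroup X] [Module ℂ X] [Module (FPS n) X]
    [IsScalarTower ℂ (FPS n) X] (T : ι → Module.End ℂ X) (χ : ι → ℂ) :
    IsWeightVec n T χ 0 := fun k i => ⟨0, by simp⟩

/-- A generator of an invariant principal ideal can be rescaled to a weight vector. -/
lemma exists_unit_isWeightVec {δ : ι → Der n} (hδ : ∀ i, δ i ∈ singularDer n)
    (hcomm : ∀ i j, ⁅δ i, δ j⁆ = 0) {f : FPS n} (hf : ∀ i, δ i ∈ logDer f) :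
    ∃ (u : (FPS n)ˣ) (χ : ι → ℂ), IsWeightVec n (opFamily δ) χ (u * f) := by
  by_cases hf0 : f = 0
  · refine ⟨1, 0, ?_⟩
    rw [hf0, mul_zero]
    exact isWeightVec_zero _ _
  have hinv : ∀ i, ∀ x ∈ Ideal.span {f}, opFamily δ i x ∈ Ideal.span {f} := by
    intro i x hx
    obtain ⟨a, rfl⟩ := Ideal.mem_span_singleton'.1 hx
    rw [opFamily_apply, Derivation.leibniz]
    exact add_mem (Ideal.mul_mem_left _ _ (hf i))
      (Ideal.mul_mem_right _ _ (Ideal.subset_span rfl))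
  have h1 := le_span_weightVec_sup (Ideal.span {f}) hδ (opFamily_leibniz δ)
    (commute_opFamily hcomm) hinv
  by_contra! hcon
  -- If no unit multiple of `f` is a weight vector, every weight vector `a * f` has `a ∈ 𝔪`, so (f)
  -- = 𝔪(f) and Nakayama forces `f = 0`.
  have h2 : Ideal.span {f} ≤ ⊥ ⊔ maximalIdeal (FPS n) • Ideal.span {f} := by
    intro x hx
    rw [bot_sup_eq]
    have h3 : Submodule.span ℂ {x | x ∈ Ideal.span {f} ∧ ∃ χ, IsWeightVec n (opFamily δ) χ x} ≤
        (maximalIdeal (FPS n) • Ideal.span {f}).restrictScalars ℂ := by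
      rw [Submodule.span_le]
      rintro x ⟨hx, χ, hχ⟩
      obtain ⟨a, rfl⟩ := Ideal.mem_span_singleton'.1 hx
      have ha : a ∈ maximalIdeal (FPS n) := by
        rw [mem_maximalIdeal, mem_nonunits_iff]
        rintro ⟨u, rfl⟩
        exact hcon u χ hχ
      exact Ideal.mul_mem_mul ha (Ideal.mem_span_singleton_self f)
    have := h1 hx
    rwa [sup_eq_right.2 h3] at this
  have h4 := Submodule.le_of_le_smul_of_le_jacobson_bot (IsNoetherian.noetherian _)
    (maximalIdeal_le_jacobson _) h2
  exact hf0 (Ideal.span_singleton_eq_bot.1 (le_bot_iff.1 h4))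

lemma inducedMap_mk {δ : Der n} (h : δ ∈ singularDer n) (k : ℕ) (g : FPS n) :
    inducedMap δ h k ((maxPow n k).mkQ g) = (maxPow n k).mkQ (δ g) := rfl

lemma mkQ_maxPow_eq_zero {k : ℕ} {g : FPS n} :
    (maxPow n k).mkQ g = 0 ↔ g ∈ maximalIdeal (FPS n) ^ k := by
  rw [Submodule.mkQ_apply, Submodule.Quotient.mk_eq_zero]
  rfl

lemma maxPow_eq_adicFil (k : ℕ) : maxPow n k = adicFil n (FPS n) k := by
  ext g
  exact mem_adicFil_self.symm

instance finiteDimensional_quotient_maxPow (k : ℕ) :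
    FiniteDimensional ℂ (FPS n ⧸ maxPow n k) := by
  rw [maxPow_eq_adicFil]
  infer_instance

lemma inducedMap_sub_smul_pow {δ : Der n} (h : δ ∈ singularDer n) (k : ℕ) (c : ℂ) (N : ℕ)
    (g : FPS n) :
    ((inducedMap δ h k - c • (1 : Module.End ℂ (FPS n ⧸ maxPow n k))) ^ N) ((maxPow n k).mkQ g) =
      (maxPow n k).mkQ
        ((((δ : FPS n →ₗ[ℂ] FPS n) - c • (1 : Module.End ℂ (FPS n))) ^ N) g) :=
  mapQ_sub_smul_pow_apply _ _ (maxPow_le_comap h k) c N g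

lemma isTopNilpotentDer_of_forall {δ : Der n} (h : δ ∈ singularDer n)
    (hnil : ∀ k g, ∃ N : ℕ, (((δ : FPS n →ₗ[ℂ] FPS n)) ^ N) g ∈ maximalIdeal (FPS n) ^ k) :
    IsTopNilpotentDer δ := by
  refine ⟨h, fun k => Module.End.isNilpotent_iff_of_finite.2 fun v => ?_⟩
  obtain ⟨g, rfl⟩ := (maxPow n k).mkQ_surjective v
  obtain ⟨N, hN⟩ := hnil k g
  refine ⟨N, ?_⟩
  have := inducedMap_sub_smul_pow h k 0 N g
  rw [zero_smul, zero_smul, sub_zero, sub_zero] at this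
  rw [this, mkQ_maxPow_eq_zero]
  exact hN

/-- Topological generalized eigenvectors of semisimple derivations are eigenvectors. -/
lemma IsSemisimpleDer.apply_eq_smul {δ : Der n} (hδ : IsSemisimpleDer δ) {c : ℂ} {g : FPS n}
    (hg : ∀ k, ∃ N : ℕ, (((δ : FPS n →ₗ[ℂ] FPS n) - c • (1 : Module.End ℂ (FPS n))) ^ N) g ∈
      maximalIdeal (FPS n) ^ k) : δ g = c • g := by
  obtain ⟨h, hss⟩ := hδ
  refine sub_eq_zero.1 (eq_zero_of_forall_mem_pow fun k => ?_)
  obtain ⟨N, hN⟩ := hg k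
  have h1 : (maxPow n k).mkQ g ∈ (inducedMap δ h k).maxGenEigenspace c := by
    rw [Module.End.mem_maxGenEigenspace]
    refine ⟨N, ?_⟩
    rw [inducedMap_sub_smul_pow, mkQ_maxPow_eq_zero]
    exact hN
  -- Eigenspaces sit inside the independent generalized eigenspaces; since they already span, the
  -- two families coincide.
  have h2 := ((Module.End.independent_maxGenEigenspace
    (inducedMap δ h k)).le_iff_eq_of_iSup_eq_top (hss k)).1
    (fun μ => Module.End.genEigenspace_le_maximal _ μ 1)
  rw [← h2, Module.End.mem_eigenspace_iff, inducedMap_mk, ← sub_eq_zero, ← map_smul,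
    ← map_sub, mkQ_maxPow_eq_zero] at h1
  exact h1

end Diagonalization

/-! ### Semisimple and nilpotent parts, adjoint weights, rationality -/

section Semisimple

variable {n : ℕ} {ι : Type*}

lemma lie_eq_zero_iff {D E : Der n} : ⁅D, E⁆ = 0 ↔ ∀ g, D (E g) = E (D g) := by
  refine ⟨fun h g => ?_, fun h => ?_⟩
  · have := congrArg (fun F : Der n => F g) h
    rwa [Derivation.commutator_apply, Derivation.zero_apply, sub_eq_zero] at this
  · ext1 g
    rw [Derivation.commutator_apply, h g, sub_self, Derivation.zero_apply]

lemma lie_sub_eq_zero {D E F : Der n} (hE : ⁅D, E⁆ = 0) (hF : ⁅F, D⁆ = 0) : ⁅D, E - F⁆ = 0 := by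
  rw [lie_eq_zero_iff] at hE hF ⊢
  intro g
  rw [Derivation.sub_apply, Derivation.sub_apply, map_sub, hE, hF]

lemma isWeightVec_of_apply_eq {δ : ι → Der n} {χ : ι → ℂ} {g : FPS n}
    (h : ∀ i, δ i g = χ i • g) : IsWeightVec n (opFamily δ) χ g := fun k i => ⟨1, by
  rw [pow_one, LinearMap.sub_apply, opFamily_apply, h i, LinearMap.smul_apply,
    Module.End.one_apply, sub_self]
  exact zero_mem _⟩

lemma FormalCoordinates.isWeightVec_coord (Y : FormalCoordinates n) (w : ι → Fin n → ℂ)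
    (j : Fin n) :
    IsWeightVec n (opFamily fun i => Y.diagDer (w i)) (fun i => w i j) (Y.coord j) :=
  isWeightVec_of_apply_eq fun i => Y.diagDer_coord (w i) j

/-- Weight vectors of a family of diagonal derivations are genuine eigenvectors. -/
lemma FormalCoordinates.diagDer_apply (Y : FormalCoordinates n) (w : ι → Fin n → ℂ) {χ : ι → ℂ}
    {g : FPS n} (hg : IsWeightVec n (opFamily fun i => Y.diagDer (w i)) χ g)
    (ψ : ℂ →+ ℂ) (i : ι) : Y.diagDer (fun j => ψ (w i j)) g = ψ (χ i) • g :=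
  diagDer_apply_of_isWeightVec (fun i => Y.diagDer_mem_singularDer (w i))
    (fun i j => Y.lie_diagDer (w i) (w j)) Y (Y.isWeightVec_coord w)
    (ψ.comp (Pi.evalAddMonoidHom (fun _ : ι => ℂ) i)) hg

lemma FormalCoordinates.isSemisimpleDer_diagDer (Y : FormalCoordinates n) (w : Fin n → ℂ) :
    IsSemisimpleDer (Y.diagDer w) := by
  refine ⟨Y.diagDer_mem_singularDer w, fun k => ?_⟩
  have htop := span_weightVec_sup (X := FPS n) (δ := fun _ : Unit => Y.diagDer w)
    (fun _ => Y.diagDer_mem_singularDer w) (opFamily_leibniz _)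
    (commute_opFamily fun _ _ => Y.lie_diagDer w w) k
  have hmap := congrArg (Submodule.map (maxPow n k).mkQ) htop
  rw [Submodule.map_sup, ← maxPow_eq_adicFil, Submodule.mkQ_map_self, sup_bot_eq,
    Submodule.map_top, Submodule.range_mkQ, Submodule.map_span] at hmap
  rw [IsDiagonalizable, ← top_le_iff, ← hmap, Submodule.span_le]
  rintro _ ⟨g, ⟨χ, hg⟩, rfl⟩
  refine Submodule.mem_iSup_of_mem (χ ()) ?_
  rw [Module.End.mem_eigenspace_iff, inducedMap_mk, ← map_smul]
  exact congrArg _ (Y.diagDer_apply (fun _ : Unit => w) hg (AddMonoidHom.id ℂ) ())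

lemma IsWeightVec.apply_of_commute {δ : ι → Der n} {χ : ι → ℂ} {g : FPS n}
    (hg : IsWeightVec n (opFamily δ) χ g) {ε : Der n} (hε : ε ∈ singularDer n)
    (hcomm : ∀ i, ⁅δ i, ε⁆ = 0) : IsWeightVec n (opFamily δ) χ (ε g) := by
  intro k i
  obtain ⟨N, hN⟩ := hg k i
  refine ⟨N, ?_⟩
  have h1 : Commute (opFamily δ i) (ε : FPS n →ₗ[ℂ] FPS n) := by
    refine LinearMap.ext fun x => ?_
    have := congrArg (fun D : Der n => D x) (hcomm i)
    simpa [Derivation.commutator_apply, sub_eq_zero, opFamily] using this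
  have h2 : Commute ((opFamily δ i - χ i • (1 : Module.End ℂ (FPS n))) ^ N)
      (ε : FPS n →ₗ[ℂ] FPS n) :=
    (h1.sub_left ((Commute.one_left _).smul_left _)).pow_left N
  have h3 := LinearMap.congr_fun h2.eq g
  change ((opFamily δ i - χ i • (1 : Module.End ℂ (FPS n))) ^ N) (ε g) = _ at h3
  rw [h3]
  rw [mem_adicFil_self] at hN ⊢
  exact der_mem_pow_of_singular hε hN

variable {δ : ι → Der n} {Y : FormalCoordinates n} {Λ : Fin n → ι → ℂ}

lemma diagDer_eval_apply (hδ : ∀ i, δ i ∈ singularDer n) (hcomm : ∀ i j, ⁅δ i, δ j⁆ = 0)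
    (hY : ∀ j, IsWeightVec n (opFamily δ) (Λ j) (Y.coord j)) {χ : ι → ℂ} {h : FPS n}
    (hh : IsWeightVec n (opFamily δ) χ h) (i : ι) :
    Y.diagDer (fun j => Λ j i) h = χ i • h :=
  diagDer_apply_of_isWeightVec hδ hcomm Y hY (Pi.evalAddMonoidHom (fun _ : ι => ℂ) i) hh

/-- The semisimple parts commute with the given derivations. -/
lemma lie_diagDer_of_isWeightVec (hδ : ∀ i, δ i ∈ singularDer n)
    (hcomm : ∀ i j, ⁅δ i, δ j⁆ = 0) (hY : ∀ j, IsWeightVec n (opFamily δ) (Λ j) (Y.coord j))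
    (i k : ι) : ⁅Y.diagDer (fun j => Λ j i), δ k⁆ = 0 := by
  refine der_eq_zero Y.span_coord fun l => ?_
  rw [Derivation.commutator_apply, Y.diagDer_coord, diagDer_eval_apply hδ hcomm hY
    ((hY l).apply_of_commute (hδ k) fun i => hcomm i k) i, Derivation.map_smul, sub_self]

/-- The difference of a derivation and its semisimple part is topologically nilpotent. -/
lemma isTopNilpotentDer_sub_diagDer (hδ : ∀ i, δ i ∈ singularDer n)
    (hcomm : ∀ i j, ⁅δ i, δ j⁆ = 0) (hY : ∀ j, IsWeightVec n (opFamily δ) (Λ j) (Y.coord j))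
    (i : ι) : IsTopNilpotentDer (δ i - Y.diagDer (fun j => Λ j i)) := by
  obtain ⟨ν, hν⟩ : ∃ ν, ν = δ i - Y.diagDer (fun j => Λ j i) := ⟨_, rfl⟩
  have hνs : ν ∈ singularDer n := hν ▸ sub_mem (hδ i) (Y.diagDer_mem_singularDer _)
  rw [← hν]
  refine isTopNilpotentDer_of_forall hνs fun k g => ?_
  -- On weight vectors of weight `χ` the semisimple part is the scalar `χ i`; iterating is allowed
  -- because `ν` commutes with the family and so preserves the weight.
  have hsub : ∀ (χ : ι → ℂ) (x : FPS n), IsWeightVec n (opFamily δ) χ x → ∀ N : ℕ,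
      ((ν : FPS n →ₗ[ℂ] FPS n) ^ N) x =
        ((opFamily δ i - χ i • (1 : Module.End ℂ (FPS n))) ^ N) x := by
    intro χ x hx N
    induction N generalizing x with
    | zero => simp
    | succ N ih =>
      have h1 : (ν : FPS n →ₗ[ℂ] FPS n) x =
          (opFamily δ i - χ i • (1 : Module.End ℂ (FPS n))) x := by
        change ν x = δ i x - χ i • x
        rw [hν, Derivation.sub_apply, diagDer_eval_apply hδ hcomm hY hx]
      rw [pow_succ, pow_succ, Module.End.mul_apply, Module.End.mul_apply, ← h1]
      refine ih _ ?_
      refine hx.apply_of_commute hνs fun l => ?_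
      rw [hν]
      exact lie_sub_eq_zero (hcomm l i) (lie_diagDer_of_isWeightVec hδ hcomm hY i l)
  have hν' : ∀ l : Unit, adicFil n (FPS n) k ≤
      (adicFil n (FPS n) k).comap ((fun _ => (ν : FPS n →ₗ[ℂ] FPS n)) l) :=
    opFamily_le_comap (δ := fun _ : Unit => ν) (fun _ => hνs) k
  have h2 : g ∈ genWeight (adicFil n (FPS n) k) (fun _ : Unit => (ν : FPS n →ₗ[ℂ] FPS n)) hν' 0 := by
    have htop := span_weightVec_sup (X := FPS n) hδ (opFamily_leibniz δ)
      (commute_opFamily hcomm) k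
    have hg : g ∈ Submodule.span ℂ {x | ∃ χ, IsWeightVec n (opFamily δ) χ x} ⊔
      adicFil n (FPS n) k := htop ▸ Submodule.mem_top
    refine (sup_le (Submodule.span_le.2 ?_) (le_genWeight _ _ _ _) :
      Submodule.span ℂ {x | ∃ χ, IsWeightVec n (opFamily δ) χ x} ⊔ adicFil n (FPS n) k ≤ _) hg
    rintro x ⟨χ, hx⟩
    refine mem_genWeight.2 fun _ => ?_
    obtain ⟨N, hN⟩ := hx k i
    refine ⟨N, ?_⟩
    rw [Pi.zero_apply, zero_smul, sub_zero, hsub χ x hx N]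
    exact hN
  obtain ⟨N, hN⟩ := mem_genWeight.1 h2 ()
  refine ⟨N, ?_⟩
  rw [Pi.zero_apply, zero_smul, sub_zero, mem_adicFil_self] at hN
  exact hN

lemma eq_diagDer_of_isSemisimpleDer (hY : ∀ j, IsWeightVec n (opFamily δ) (Λ j) (Y.coord j))
    {i : ι} (hi : IsSemisimpleDer (δ i)) : δ i = Y.diagDer (fun j => Λ j i) := by
  refine der_ext Y.span_coord fun j => ?_
  rw [Y.diagDer_coord]
  refine hi.apply_eq_smul fun k => ?_
  obtain ⟨N, hN⟩ := hY j k i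
  exact ⟨N, mem_adicFil_self.1 hN⟩

/-- By Leibniz, u·D(f) differs from a multiple of f by f·D(u); then cancel the unit. -/
lemma mem_logDer_of_apply_eq {f : FPS n} (u : (FPS n)ˣ) {D : Der n} {c : ℂ}
    (h : D (u * f) = c • ((u : FPS n) * f)) : D ∈ logDer f := by
  have h1 : (u : FPS n) * D f ∈ Ideal.span {f} := by
    rw [Derivation.leibniz, smul_eq_mul, smul_eq_mul, ← eq_sub_iff_add_eq] at h
    rw [h, Algebra.smul_def, ← mul_assoc]
    exact sub_mem (Ideal.mul_mem_left _ _ (Ideal.mem_span_singleton_self f))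
      (Ideal.mul_mem_right _ _ (Ideal.mem_span_singleton_self f))
  have h2 := Ideal.mul_mem_left _ ((u⁻¹ : (FPS n)ˣ) : FPS n) h1
  rwa [Units.inv_mul_cancel_left] at h2

lemma apply_mem_of_mem_smul_logDer {f : FPS n} (hf : logDer f ≤ singularDer n) {D : Der n}
    (hD : D ∈ maximalIdeal (FPS n) • logDer f) (g : FPS n) : D g ∈ maximalIdeal (FPS n) ^ 2 := by
  refine Submodule.smul_induction_on hD (fun a ha ε hε => ?_) fun a b ha hb => ?_
  · rw [Derivation.smul_apply, smul_eq_mul, pow_two]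
    exact Ideal.mul_mem_mul ha (apply_mem_maximalIdeal (hf hε) g)
  · exact add_mem ha hb

/-- A nonzero eigenvalue `w j` would put the coordinate `Y.coord j` into 𝔪². The inclusion of Der_f
in 𝔪 · Der enters here. -/
lemma FormalCoordinates.diagDer_eq_zero_of_mem (Y : FormalCoordinates n) {f : FPS n}
    (hf : logDer f ≤ singularDer n) {w : Fin n → ℂ}
    (hw : Y.diagDer w ∈ maximalIdeal (FPS n) • logDer f) : Y.diagDer w = 0 := by
  refine der_eq_zero Y.span_coord fun j => ?_
  have h1 := apply_mem_of_mem_smul_logDer hf hw (Y.coord j)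
  rw [Y.diagDer_coord] at h1 ⊢
  by_cases h0 : w j = 0
  · rw [h0, zero_smul]
  · have h2 := Ideal.mul_mem_left _ (algebraMap ℂ (FPS n) (w j)⁻¹) h1
    rw [← Algebra.smul_def, smul_smul, inv_mul_cancel₀ h0, one_smul] at h2
    exact absurd h2 (Y.coord_notMem_sq j)

/-- An eigenvector of `ad S` for a nonzero eigenvalue is nilpotent. -/
lemma isNilpotent_of_lie_eq_smul {V : Type*} [AddCommGroup V] [Module ℂ V]
    [FiniteDimensional ℂ V] {S N : Module.End ℂ V} {c : ℂ} (hc : c ≠ 0)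
    (h : S * N - N * S = c • N) : IsNilpotent N := by
  by_contra hN
  have hN' : ∀ m : ℕ, N ^ m ≠ 0 := fun m hm => hN ⟨m, hm⟩
  obtain ⟨A, hA⟩ : ∃ A : Module.End ℂ (Module.End ℂ V),
      A = LinearMap.mulLeft ℂ S - LinearMap.mulRight ℂ S := ⟨_, rfl⟩
  have hAx : ∀ x, A x = S * x - x * S := fun x => by rw [hA]; rfl
  have h1 : ∀ m : ℕ, A (N ^ m) = ((m : ℂ) * c) • N ^ m := by
    intro m
    induction m with
    | zero => rw [hAx]; simp
    | succ m ih =>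
      rw [hAx] at ih ⊢
      have h2 : S * N ^ (m + 1) - N ^ (m + 1) * S =
          (S * N ^ m - N ^ m * S) * N + N ^ m * (S * N - N * S) := by
        rw [pow_succ]; noncomm_ring
      rw [h2, ih, h, smul_mul_assoc, mul_smul_comm, ← pow_succ, ← add_smul]
      push_cast
      ring_nf
  have h3 : ∀ m : ℕ, A.HasEigenvalue ((m : ℂ) * c) := fun m =>
    Module.End.hasEigenvalue_of_hasEigenvector
      ⟨Module.End.mem_eigenspace_iff.2 (h1 m), hN' m⟩
  have h4 : (Set.range fun m : ℕ => (m : ℂ) * c).Finite :=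
    A.finite_hasEigenvalue.subset (by rintro _ ⟨m, rfl⟩; exact h3 m)
  exact Set.infinite_range_of_injective
    (fun a b hab => by simpa using mul_right_cancel₀ hc hab) h4

lemma isTopNilpotentDer_of_lie_eq_smul {σ ν : Der n} (hσ : σ ∈ singularDer n)
    (hν : ν ∈ singularDer n) {c : ℂ} (hc : c ≠ 0) (h : ⁅σ, ν⁆ = c • ν) :
    IsTopNilpotentDer ν := by
  refine ⟨hν, fun k => isNilpotent_of_lie_eq_smul (S := inducedMap σ hσ k) hc ?_⟩
  refine LinearMap.ext fun v => ?_
  obtain ⟨g, rfl⟩ := (maxPow n k).mkQ_surjective v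
  have := congrArg (fun D : Der n => (maxPow n k).mkQ (D g)) h
  rw [Derivation.commutator_apply, map_sub, Derivation.smul_apply, map_smul] at this
  exact this

/-- The adjoint operators of a family of derivations. -/
noncomputable def adFamily (σ : ι → Der n) (i : ι) : Module.End ℂ (Der n) :=
  LieAlgebra.ad ℂ (Der n) (σ i)

lemma adFamily_apply (σ : ι → Der n) (i : ι) (D : Der n) : adFamily σ i D = ⁅σ i, D⁆ := rfl

lemma adFamily_leibniz (σ : ι → Der n) (i : ι) (a : FPS n) (D : Der n) :
    adFamily σ i (a • D) = σ i a • D + a • adFamily σ i D := by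
  ext1 g
  simp only [adFamily_apply, Derivation.commutator_apply, Derivation.add_apply,
    Derivation.smul_apply, Derivation.leibniz, smul_eq_mul]
  ring

lemma commute_adFamily {σ : ι → Der n} (hcomm : ∀ i j, ⁅σ i, σ j⁆ = 0) (i j : ι) :
    Commute (adFamily σ i) (adFamily σ j) := by
  refine LinearMap.ext fun D => ?_
  change ⁅σ i, ⁅σ j, D⁆⁆ = ⁅σ j, ⁅σ i, D⁆⁆
  ext1 g
  have h1 := lie_eq_zero_iff.1 (hcomm i j)
  simp only [Derivation.commutator_apply, map_sub, h1]
  abel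

lemma IsWeightVec.der_apply {σ : ι → Der n} (hσ : ∀ i, σ i ∈ singularDer n) {χ θ : ι → ℂ}
    {ν : Der n} (hν : IsWeightVec n (adFamily σ) χ ν) {g : FPS n}
    (hg : IsWeightVec n (opFamily σ) θ g) : IsWeightVec n (opFamily σ) (χ + θ) (ν g) := by
  intro k i
  obtain ⟨p, hp⟩ := hν k i
  -- The extra order compensates for an arbitrary derivation lowering the order by one.
  obtain ⟨q, hq⟩ := hg (k + 1) i
  let β : Der n →ₗ[ℂ] FPS n →ₗ[ℂ] FPS n :=
    { toFun := fun D => D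
      map_add' := fun _ _ => rfl
      map_smul' := fun _ _ => rfl }
  refine ⟨p + q, leibniz_pow_mem β (adFamily σ i) (opFamily σ i) (opFamily σ i) (fun D x => ?_)
    (opFamily_le_comap hσ k i) (fun D hD x => ?_) (fun D x hx => ?_) p q hp hq⟩
  · change σ i (D x) = ⁅σ i, D⁆ x + D (σ i x)
    rw [Derivation.commutator_apply, sub_add_cancel]
  · rw [mem_adicFil_self]
    change D x ∈ _
    refine Submodule.smul_induction_on (mem_adicFil.1 hD) (fun a ha ε _ => ?_)
      fun a b ha hb => add_mem ha hb
    exact Ideal.mul_mem_right _ _ ha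
  · rw [mem_adicFil_self] at hx ⊢
    exact der_mem_pow D k hx

/-- The image `ν (Y.coord j)` has weight `χ + w · j`, on which the diagonal derivation is a genuine
scalar; the contribution of the coordinate cancels in the bracket. -/
lemma FormalCoordinates.lie_eq_smul_of_isWeightVec (Y : FormalCoordinates n) (w : ι → Fin n → ℂ)
    {χ : ι → ℂ} {ν : Der n} (hν : IsWeightVec n (adFamily fun i => Y.diagDer (w i)) χ ν) (i : ι) :
    ⁅Y.diagDer (w i), ν⁆ = χ i • ν := by
  refine der_ext Y.span_coord fun j => ?_
  have h1 := Y.diagDer_apply w (hν.der_apply (fun i => Y.diagDer_mem_singularDer (w i))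
    (Y.isWeightVec_coord w j)) (AddMonoidHom.id ℂ) i
  simp only [AddMonoidHom.id_apply, Pi.add_apply] at h1
  rw [Derivation.commutator_apply, Y.diagDer_coord, Derivation.map_smul, h1, add_smul,
    add_sub_cancel_right, Derivation.smul_apply]

lemma exists_ratCast_retraction : ∃ ρ : ℂ →ₗ[ℚ] ℚ, ∀ q : ℚ, ρ q = q := by
  obtain ⟨ρ, hρ⟩ := (Algebra.linearMap ℚ ℂ).exists_leftInverse_of_injective
    (LinearMap.ker_eq_bot.2 (algebraMap ℚ ℂ).injective)
  exact ⟨ρ, fun q => by simpa using LinearMap.congr_fun hρ q⟩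

/-- Diagonal derivations with rational eigenvalues on the coordinates have rational weights. -/
lemma FormalCoordinates.exists_rat_weight (Y : FormalCoordinates n) (w : ι → Fin n → ℚ)
    {χ : ι → ℂ} {g : FPS n} (hg0 : g ≠ 0)
    (hg : IsWeightVec n (opFamily fun i => Y.diagDer fun j => (w i j : ℂ)) χ g) (i : ι) :
    ∃ c : ℚ, χ i = c := by
  obtain ⟨ρ, hρ⟩ := exists_ratCast_retraction
  have h1 := Y.diagDer_apply (fun i j => (w i j : ℂ)) hg (AddMonoidHom.id ℂ) i
  have h2 := Y.diagDer_apply (fun i j => (w i j : ℂ)) hg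
    ((algebraMap ℚ ℂ).toAddMonoidHom.comp ρ.toAddMonoidHom) i
  refine ⟨ρ (χ i), smul_left_injective ℂ hg0 ?_⟩
  -- The retraction fixes the rational `w i j`, so both functionals give the same derivation, and
  -- its eigenvalues on `g`, namely `χ i` and `ρ (χ i)`, agree.
  have h3 : (fun j => ((algebraMap ℚ ℂ).toAddMonoidHom.comp ρ.toAddMonoidHom) (w i j : ℂ)) =
      fun j => (AddMonoidHom.id ℂ) (w i j : ℂ) := by
    ext1 j
    simp [hρ]
  rw [h3] at h2
  exact h1.symm.trans h2

end Semisimple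

/-! ### Minimal generating sets as bases modulo 𝔪M -/

section MinimalGenerators

variable {n : ℕ}

/-- The projection of `Der` modulo `𝔪 M`, as a complex linear map. -/
noncomputable def modMax (M : Submodule (FPS n) (Der n)) :
    Der n →ₗ[ℂ] Der n ⧸ (maximalIdeal (FPS n) • M).restrictScalars ℂ :=
  ((maximalIdeal (FPS n) • M).restrictScalars ℂ).mkQ

variable {M : Submodule (FPS n) (Der n)}

lemma modMax_eq_zero {x : Der n} : modMax M x = 0 ↔ x ∈ maximalIdeal (FPS n) • M := by
  rw [modMax, Submodule.mkQ_apply, Submodule.Quotient.mk_eq_zero]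
  rfl

lemma modMax_mem_span {S : Set (Der n)} {x : Der n} (hx : x ∈ Submodule.span ℂ S ⊔
    (maximalIdeal (FPS n) • M).restrictScalars ℂ) :
    modMax M x ∈ Submodule.span ℂ (modMax M '' S) := by
  obtain ⟨v, hv, z, hz, rfl⟩ := Submodule.mem_sup.1 hx
  rw [map_add, modMax_eq_zero.2 hz, add_zero, ← Submodule.map_span]
  exact Submodule.mem_map_of_mem hv

lemma mem_span_sup_of_modMax_mem_span {S : Set (Der n)} {x : Der n}
    (hx : modMax M x ∈ Submodule.span ℂ (modMax M '' S)) :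
    x ∈ Submodule.span ℂ S ⊔ (maximalIdeal (FPS n) • M).restrictScalars ℂ := by
  rw [← Submodule.map_span] at hx
  obtain ⟨v, hv, hvx⟩ := hx
  refine Submodule.mem_sup.2 ⟨v, hv, x - v, ?_, by simp⟩
  rw [Submodule.restrictScalars_mem, ← modMax_eq_zero, map_sub, hvx, sub_self]

lemma span_eq_of_le_sup {S : Set (Der n)} (hS : S ⊆ M)
    (h : M.restrictScalars ℂ ≤ Submodule.span ℂ S ⊔
      (maximalIdeal (FPS n) • M).restrictScalars ℂ) : Submodule.span (FPS n) S = M := by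
  refine le_antisymm (Submodule.span_le.2 hS) ?_
  refine Submodule.le_of_le_smul_of_le_jacobson_bot (IsNoetherian.noetherian _)
    (maximalIdeal_le_jacobson _) fun x hx => ?_
  obtain ⟨v, hv, z, hz, rfl⟩ := Submodule.mem_sup.1 (h hx)
  exact Submodule.add_mem_sup (Submodule.span_le_restrictScalars ℂ (FPS n) S hv) hz

lemma isMinimalGenerating_of_linearIndepOn {S : Set (Der n)} (hS : S ⊆ M)
    (hli : LinearIndepOn ℂ (modMax M) S) (h : M.restrictScalars ℂ ≤ Submodule.span ℂ S ⊔
      (maximalIdeal (FPS n) • M).restrictScalars ℂ) : IsMinimalGenerating M S := by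
  refine ⟨span_eq_of_le_sup hS h, fun S' hS' hle x hx => ?_⟩
  have h1 : x ∈ Submodule.span (FPS n) S' := hS'.symm ▸ hS hx
  have h2 := mem_span_sup_of_mem_span h1
  rw [show Submodule.span (FPS n) S' = M from hS'] at h2
  exact (hli.mono hle).mem_span_iff.1 (modMax_mem_span h2)
    (hli.mono (Set.insert_subset hx hle))

/-- A maximal subset of `S` independent modulo 𝔪M already generates by Nakayama, hence equals `S` by
minimality. -/
lemma IsMinimalGenerating.linearIndepOn {S : Set (Der n)} (hS : IsMinimalGenerating M S) :
    LinearIndepOn ℂ (modMax M) S := by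
  have hspan : Submodule.span (FPS n) S = M := hS.1
  have hSM : S ⊆ M := hspan ▸ Submodule.subset_span
  obtain ⟨b, hbS, -, hb, hli⟩ := exists_linearIndepOn_extension
    (linearIndepOn_empty ℂ (modMax M)) (Set.empty_subset S)
  have h1 : M.restrictScalars ℂ ≤ Submodule.span ℂ b ⊔
      (maximalIdeal (FPS n) • M).restrictScalars ℂ := by
    intro x hx
    have h2 : x ∈ Submodule.span (FPS n) S := hspan.symm ▸ hx
    have h3 := mem_span_sup_of_mem_span h2
    rw [hspan] at h3
    exact mem_span_sup_of_modMax_mem_span (Submodule.span_le.2 hb (modMax_mem_span h3))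
  have h4 : S ⊆ b := hS.2 (span_eq_of_le_sup (hbS.trans hSM) h1) hbS
  exact hli.mono h4

/-- Independent elements modulo `𝔪 M` extend to minimal generating sets. -/
lemma exists_isMinimalGenerating {T G : Set (Der n)} (hT : LinearIndepOn ℂ (modMax M) T)
    (hTG : T ⊆ G) (hG : G ⊆ M) (h : M.restrictScalars ℂ ≤ Submodule.span ℂ G ⊔
      (maximalIdeal (FPS n) • M).restrictScalars ℂ) :
    ∃ S, T ⊆ S ∧ S ⊆ G ∧ IsMinimalGenerating M S := by
  obtain ⟨b, hbG, hTb, hb, hli⟩ := exists_linearIndepOn_extension hT hTG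
  refine ⟨b, hTb, hbG, isMinimalGenerating_of_linearIndepOn (hbG.trans hG) hli fun x hx => ?_⟩
  exact mem_span_sup_of_modMax_mem_span (Submodule.span_le.2 hb (modMax_mem_span (h hx)))

lemma IsMinimalGenerating.finite {S : Set (Der n)} (hS : IsMinimalGenerating M S) :
    S.Finite := by
  have hspan : Submodule.span (FPS n) S = M := hS.1
  have hfg : (Submodule.span (FPS n) S).FG := IsNoetherian.noetherian _
  obtain ⟨s, hsS, hs⟩ := Submodule.fg_span_iff_fg_span_finset_subset S |>.1 hfg
  exact s.finite_toSet.subset (hS.2 (hs.symm.trans hspan) hsS)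

end MinimalGenerators

/-! ### Toral sets of maximal size and adapted generators -/

section Toral

variable {n : ℕ} {f : FPS n}

/-- A finite, linearly independent set of commuting semisimple logarithmic derivations. -/
structure IsToral (f : FPS n) (T : Finset (Der n)) : Prop where
  mem : ∀ δ ∈ T, δ ∈ logDer f
  semisimple : ∀ δ ∈ T, IsSemisimpleDer δ
  lie_eq_zero : ∀ δ ∈ T, ∀ ε ∈ T, ⁅δ, ε⁆ = 0
  linearIndepOn : LinearIndepOn ℂ id (T : Set (Der n))

/-- The map sending a weight to the corresponding diagonal derivation. -/
noncomputable def FormalCoordinates.diagLin (Y : FormalCoordinates n) :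
    (Fin n → ℂ) →ₗ[ℂ] Der n where
  toFun := Y.diagDer
  map_add' := Y.diagDer_add
  map_smul' := Y.diagDer_smul

lemma FormalCoordinates.diagLin_apply (Y : FormalCoordinates n) (w : Fin n → ℂ) :
    Y.diagLin w = Y.diagDer w := rfl

lemma exists_diagonal_coordinates (hf : logDer f ≤ singularDer n) {T : Set (Der n)}
    (hmem : ∀ δ ∈ T, δ ∈ logDer f) (hss : ∀ δ ∈ T, IsSemisimpleDer δ)
    (hcomm : ∀ δ ∈ T, ∀ ε ∈ T, ⁅δ, ε⁆ = 0) :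
    ∃ (Y : FormalCoordinates n) (w : T → Fin n → ℂ) (u : (FPS n)ˣ) (χ : T → ℂ),
      (∀ τ : T, (τ : Der n) = Y.diagDer (w τ)) ∧
      IsWeightVec n (opFamily fun τ => Y.diagDer (w τ)) χ (u * f) := by
  have hs : ∀ τ : T, (τ : Der n) ∈ singularDer n := fun τ => hf (hmem τ τ.2)
  have hc : ∀ τ ε : T, ⁅(τ : Der n), (ε : Der n)⁆ = 0 := fun τ ε => hcomm τ τ.2 ε ε.2
  obtain ⟨Y, Λ, hY⟩ := exists_weight_coordinates (δ := fun τ : T => (τ : Der n)) hs hc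
  obtain ⟨u, χ, hu⟩ := exists_unit_isWeightVec (δ := fun τ : T => (τ : Der n)) hs hc
    fun τ => hmem τ τ.2
  have h1 : ∀ τ : T, (τ : Der n) = Y.diagDer (fun j => Λ j τ) := fun τ =>
    eq_diagDer_of_isSemisimpleDer (δ := fun τ : T => (τ : Der n)) hY (hss τ τ.2)
  refine ⟨Y, fun τ j => Λ j τ, u, χ, h1, ?_⟩
  have h2 : (fun τ : T => Y.diagDer (fun j => Λ j τ)) = fun τ : T => (τ : Der n) :=
    funext fun τ => (h1 τ).symm
  rw [h2]
  exact hu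

lemma span_le_range_diagLin {Y : FormalCoordinates n} {T : Set (Der n)} {w : T → Fin n → ℂ}
    (h : ∀ τ : T, (τ : Der n) = Y.diagDer (w τ)) :
    Submodule.span ℂ T ≤ LinearMap.range Y.diagLin :=
  Submodule.span_le.2 fun τ hτ => ⟨w ⟨τ, hτ⟩, (h ⟨τ, hτ⟩).symm⟩

lemma IsToral.linearIndepOn_modMax (hf : logDer f ≤ singularDer n) {T : Finset (Der n)}
    (hT : IsToral f T) : LinearIndepOn ℂ (modMax (logDer f)) (T : Set (Der n)) := by
  obtain ⟨Y, w, -, -, hw, -⟩ := exists_diagonal_coordinates hf (T := (T : Set (Der n)))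
    hT.mem hT.semisimple hT.lie_eq_zero
  refine LinearIndependent.map (v := fun x : (T : Set (Der n)) => (x : Der n))
    hT.linearIndepOn ?_
  rw [Subtype.range_coe, Submodule.disjoint_def]
  intro x hx hx'
  obtain ⟨v, rfl⟩ := span_le_range_diagLin hw hx
  exact Y.diagDer_eq_zero_of_mem hf (modMax_eq_zero.1 hx')

lemma IsToral.card_le (hf : logDer f ≤ singularDer n) {T : Finset (Der n)}
    (hT : IsToral f T) : T.card ≤ n := by
  obtain ⟨Y, w, -, -, hw, -⟩ := exists_diagonal_coordinates hf (T := (T : Set (Der n)))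
    hT.mem hT.semisimple hT.lie_eq_zero
  have h1 : LinearIndependent ℂ w := by
    refine LinearIndependent.of_comp Y.diagLin ?_
    have h2 : Y.diagLin ∘ w = fun x : (T : Set (Der n)) => (x : Der n) :=
      funext fun τ => (hw τ).symm
    rw [h2]
    exact hT.linearIndepOn
  have := h1.fintype_card_le_finrank
  simpa using this

/-- This replaces the condition on minimal generating sets by linear independence over ℂ, which
makes the maximality arguments linear algebra. -/
lemma mem_commutingSemisimpleCounts_iff (hf : logDer f ≤ singularDer n) {k : ℕ} :
    k ∈ commutingSemisimpleCounts f ↔ ∃ T : Finset (Der n), IsToral f T ∧ T.card = k := by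
  constructor
  · rintro ⟨S, T, hS, hTS, hss, hcomm, rfl⟩
    refine ⟨T, ⟨fun δ hδ => ?_, hss, hcomm, ?_⟩, rfl⟩
    · have hspan : Submodule.span (FPS n) S = logDer f := hS.1
      exact hspan ▸ Submodule.subset_span (hTS hδ)
    · exact LinearIndependent.of_comp (modMax (logDer f)) (hS.linearIndepOn.mono hTS)
  · rintro ⟨T, hT, rfl⟩
    obtain ⟨S, hTS, -, hS⟩ := exists_isMinimalGenerating (hT.linearIndepOn_modMax hf)
      (G := (logDer f : Set (Der n))) (fun x hx => hT.mem x hx) le_rfl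
      fun x hx => Submodule.mem_sup_left (Submodule.subset_span hx)
    exact ⟨S, T, hS, hTS, hT.semisimple, hT.lie_eq_zero, rfl⟩

/-- A toral set of maximal size spans all semisimple logarithmic derivations commuting with it. -/
lemma IsToral.mem_span_of_maximal {T : Finset (Der n)} (hT : IsToral f T)
    (hmax : ∀ T' : Finset (Der n), IsToral f T' → T'.card ≤ T.card) {τ : Der n}
    (hτ : τ ∈ logDer f) (hss : IsSemisimpleDer τ) (hcomm : ∀ δ ∈ T, ⁅δ, τ⁆ = 0) :
    τ ∈ Submodule.span ℂ (T : Set (Der n)) := by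
  classical
  by_contra hcon
  have hnot : τ ∉ T := fun h => hcon (Submodule.subset_span h)
  have hcomm' : ∀ δ ∈ T, ⁅τ, δ⁆ = 0 := fun δ hδ =>
    lie_eq_zero_iff.2 fun g => (lie_eq_zero_iff.1 (hcomm δ hδ) g).symm
  have := hmax (insert τ T)
    { mem := by
        intro δ hδ
        rcases Finset.mem_insert.1 hδ with rfl | h
        exacts [hτ, hT.mem _ h]
      semisimple := by
        intro δ hδ
        rcases Finset.mem_insert.1 hδ with rfl | h
        exacts [hss, hT.semisimple _ h]
      lie_eq_zero := by
        intro δ hδ ε hε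
        rcases Finset.mem_insert.1 hδ with rfl | h <;> rcases Finset.mem_insert.1 hε with rfl | h'
        · exact lie_eq_zero_iff.2 fun g => rfl
        · exact hcomm' _ h'
        · exact hcomm _ h
        · exact hT.lie_eq_zero _ h _ h'
      linearIndepOn := by
        rw [Finset.coe_insert]
        exact hT.linearIndepOn.id_insert hcon }
  rw [Finset.card_insert_of_notMem hnot] at this
  omega

/-- A complex vector is a complex combination of its images under `ℚ`-linear functionals. -/
lemma mem_span_rational (v : Fin n → ℂ) : v ∈ Submodule.span ℂ
    (Set.range fun ψ : ℂ →ₗ[ℚ] ℚ => fun j => ((ψ (v j) : ℚ) : ℂ)) := by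
  classical
  let B := Module.Basis.ofVectorSpace ℚ ℂ
  let s := Finset.univ.biUnion fun j => (B.repr (v j)).support
  have h1 : v = ∑ b ∈ s, B b • fun j => (((B.coord b) (v j) : ℚ) : ℂ) := by
    ext j
    rw [Finset.sum_apply]
    conv_lhs => rw [← B.linearCombination_repr (v j)]
    rw [Finsupp.linearCombination_apply, Finsupp.sum_of_support_subset (s := s) _
      (Finset.subset_biUnion_of_mem (fun j => (B.repr (v j)).support) (Finset.mem_univ j)) _
      (by simp)]
    refine Finset.sum_congr rfl fun b _ => ?_
    rw [Pi.smul_apply, smul_eq_mul, Module.Basis.coord_apply, Rat.smul_def, mul_comm]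
  have h2 : ∑ b ∈ s, B b • (fun j => (((B.coord b) (v j) : ℚ) : ℂ)) ∈ Submodule.span ℂ
      (Set.range fun ψ : ℂ →ₗ[ℚ] ℚ => fun j => ((ψ (v j) : ℚ) : ℂ)) :=
    sum_mem fun b _ => Submodule.smul_mem _ _ (Submodule.subset_span ⟨B.coord b, rfl⟩)
  rwa [← h1] at h2

/-- The span of a toral set of maximal size has a basis of rational diagonal derivations. -/
lemma IsToral.exists_rational (hf : logDer f ≤ singularDer n) {T : Finset (Der n)}
    (hT : IsToral f T) (hmax : ∀ T' : Finset (Der n), IsToral f T' → T'.card ≤ T.card) :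
    ∃ (T' : Finset (Der n)) (Y : FormalCoordinates n) (u : (FPS n)ˣ), IsToral f T' ∧
      T'.card = T.card ∧ ∀ τ ∈ T', (∃ w : Fin n → ℚ, τ = Y.diagDer fun j => (w j : ℂ)) ∧
        ∃ c : ℂ, τ (u * f) = c • ((u : FPS n) * f) := by
  obtain ⟨Y, w, u, χ, hw, hu⟩ := exists_diagonal_coordinates hf (T := (T : Set (Der n)))
    hT.mem hT.semisimple hT.lie_eq_zero
  obtain ⟨V, hV⟩ : ∃ V, V = Submodule.span ℂ (T : Set (Der n)) := ⟨_, rfl⟩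
  let X : Set (Der n) := {D | D ∈ V ∧ ∃ v : Fin n → ℚ, D = Y.diagDer fun j => (v j : ℂ)}
  have hdiag : ∀ D ∈ V, ∃ v, D = Y.diagDer v := fun D hD => by
    obtain ⟨v, hv⟩ := span_le_range_diagLin hw (hV ▸ hD)
    exact ⟨v, hv.symm⟩
  have heig : ∀ D ∈ V, ∃ c : ℂ, D (u * f) = c • ((u : FPS n) * f) := by
    intro D hD
    rw [hV] at hD
    induction hD using Submodule.span_induction with
    | mem D hD =>
      have := Y.diagDer_apply w hu (AddMonoidHom.id ℂ) ⟨D, hD⟩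
      exact ⟨χ ⟨D, hD⟩, (congrArg (fun E : Der n => E (u * f)) (hw ⟨D, hD⟩)).trans this⟩
    | zero => exact ⟨0, by simp⟩
    | add D E _ _ hD hE =>
      obtain ⟨c, hc⟩ := hD
      obtain ⟨d, hd⟩ := hE
      exact ⟨c + d, by rw [Derivation.add_apply, hc, hd, add_smul]⟩
    | smul a D _ hD =>
      obtain ⟨c, hc⟩ := hD
      exact ⟨a * c, by rw [Derivation.smul_apply, hc, mul_smul]⟩
  have hXV : Submodule.span ℂ X = V := by
    refine le_antisymm (Submodule.span_le.2 fun D hD => hD.1) ?_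
    rw [hV, Submodule.span_le]
    intro τ hτ
    -- Applying `ψ` to the eigenvalues of `τ` keeps `u * f` an eigenvector, so the result is
    -- logarithmic; it is diagonal, commutes with `T`, and maximality puts it in `V`.
    have h1 : ∀ ψ : ℂ →ₗ[ℚ] ℚ, Y.diagDer (fun j => ((ψ (w ⟨τ, hτ⟩ j) : ℚ) : ℂ)) ∈ X := by
      intro ψ
      refine ⟨hV ▸ hT.mem_span_of_maximal hmax (mem_logDer_of_apply_eq u (Y.diagDer_apply w hu
        ((algebraMap ℚ ℂ).toAddMonoidHom.comp ψ.toAddMonoidHom) ⟨τ, hτ⟩))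
        (Y.isSemisimpleDer_diagDer _) fun δ hδ => ?_, fun j => ψ (w ⟨τ, hτ⟩ j), rfl⟩
      have h2 := Y.lie_diagDer (w ⟨δ, hδ⟩) (fun j => ((ψ (w ⟨τ, hτ⟩ j) : ℚ) : ℂ))
      rwa [← hw ⟨δ, hδ⟩] at h2
    have h3 := Submodule.mem_map_of_mem (f := Y.diagLin) (mem_span_rational (w ⟨τ, hτ⟩))
    rw [Submodule.map_span, Y.diagLin_apply, ← hw ⟨τ, hτ⟩] at h3
    refine Submodule.span_mono ?_ h3
    rintro _ ⟨_, ⟨ψ, rfl⟩, rfl⟩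
    exact h1 ψ
  obtain ⟨b, hbX, hb, hli⟩ := exists_linearIndependent ℂ X
  have hfin : FiniteDimensional ℂ V := hV ▸ FiniteDimensional.span_finset ℂ T
  have hbV : Submodule.span ℂ b = V := hb.trans hXV
  have hbfin : b.Finite := by
    have h4 : LinearIndependent ℂ (fun x : b => (⟨x, (hbX x.2).1⟩ : V)) :=
      LinearIndependent.of_comp V.subtype hli
    have := h4.finite
    exact Set.toFinite b
  obtain ⟨T', rfl⟩ := hbfin.exists_finset_coe
  refine ⟨T', Y, u, ⟨fun δ hδ => ?_, fun δ hδ => ?_, fun δ hδ ε hε => ?_, hli⟩, ?_,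
    fun τ hτ => ⟨(hbX hτ).2, heig τ (hbX hτ).1⟩⟩
  · obtain ⟨c, hc⟩ := heig δ (hbX hδ).1
    exact mem_logDer_of_apply_eq u hc
  · obtain ⟨v, rfl⟩ := hdiag δ (hbX hδ).1
    exact Y.isSemisimpleDer_diagDer v
  · obtain ⟨v, rfl⟩ := hdiag δ (hbX hδ).1
    obtain ⟨v', rfl⟩ := hdiag ε (hbX hε).1
    exact Y.lie_diagDer v v'
  · have h5 := finrank_span_finset_eq_card hli
    have h6 := finrank_span_finset_eq_card hT.linearIndepOn
    rw [← h5, ← h6, hbV, hV]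

/-- The topologically nilpotent part of a logarithmic derivation commuting with a toral set of
maximal size. -/
lemma IsToral.exists_nilpotent_part (hf : logDer f ≤ singularDer n) {T : Finset (Der n)}
    (hT : IsToral f T) (hmax : ∀ T' : Finset (Der n), IsToral f T' → T'.card ≤ T.card)
    {ν : Der n} (hν : ν ∈ logDer f) (hcomm : ∀ δ ∈ T, ⁅δ, ν⁆ = 0) :
    ∃ σ ∈ Submodule.span ℂ (T : Set (Der n)), ν - σ ∈ logDer f ∧ IsTopNilpotentDer (ν - σ) ∧
      ∀ δ ∈ T, ⁅δ, ν - σ⁆ = 0 := by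
  -- Adjoin `ν` to the torus as the index `none`, so that the semisimple part of `ν` is built from
  -- weights of the whole commuting family and commutes with `T`.
  let δ : Option T → Der n := fun o => o.elim ν fun τ => τ
  have hmem : ∀ o, δ o ∈ logDer f := by
    rintro (_ | τ)
    exacts [hν, hT.mem τ τ.2]
  have hs : ∀ o, δ o ∈ singularDer n := fun o => hf (hmem o)
  have hc : ∀ o o', ⁅δ o, δ o'⁆ = 0 := by
    rintro (_ | τ) (_ | ε)
    · exact lie_eq_zero_iff.2 fun g => rfl
    · exact lie_eq_zero_iff.2 fun g => (lie_eq_zero_iff.1 (hcomm ε ε.2) g).symm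
    · exact hcomm τ τ.2
    · exact hT.lie_eq_zero τ τ.2 ε ε.2
  obtain ⟨Y, Λ, hY⟩ := exists_weight_coordinates hs hc
  obtain ⟨u, χ, hu⟩ := exists_unit_isWeightVec hs hc hmem
  obtain ⟨σ, hσ⟩ : ∃ σ, σ = Y.diagDer (fun j => Λ j none) := ⟨_, rfl⟩
  have hσlog : σ ∈ logDer f := hσ ▸ mem_logDer_of_apply_eq u (diagDer_eval_apply hs hc hY hu none)
  have hσc : ∀ τ ∈ T, ⁅σ, τ⁆ = 0 := fun τ hτ =>
    hσ ▸ lie_diagDer_of_isWeightVec hs hc hY none (some ⟨τ, hτ⟩)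
  refine ⟨σ, hT.mem_span_of_maximal hmax hσlog (hσ ▸ Y.isSemisimpleDer_diagDer _) fun τ hτ => ?_,
    sub_mem hν hσlog, hσ ▸ isTopNilpotentDer_sub_diagDer hs hc hY none,
    fun τ hτ => lie_sub_eq_zero (hcomm τ hτ) (hσc τ hτ)⟩
  exact lie_eq_zero_iff.2 fun g => (lie_eq_zero_iff.1 (hσc τ hτ) g).symm

lemma lie_mem_logDer {D E : Der n} (hD : D ∈ logDer f) (hE : E ∈ logDer f) :
    ⁅D, E⁆ ∈ logDer f := by
  have hinv : ∀ {D : Der n}, D ∈ logDer f → ∀ x ∈ Ideal.span {f}, D x ∈ Ideal.span {f} := by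
    intro D hD x hx
    obtain ⟨a, rfl⟩ := Ideal.mem_span_singleton'.1 hx
    rw [Derivation.leibniz]
    exact add_mem (Ideal.mul_mem_left _ _ hD)
      (Ideal.mul_mem_right _ _ (Ideal.mem_span_singleton_self f))
  change ⁅D, E⁆ f ∈ Ideal.span {f}
  rw [Derivation.commutator_apply]
  exact sub_mem (hinv hD _ hE) (hinv hE _ hD)

/-- Generators of `Der_f` adapted to a toral set of maximal size consisting of rational diagonal
derivations. -/
lemma logDer_le_span_sup (hf : logDer f ≤ singularDer n) {T : Finset (Der n)}
    (hT : IsToral f T) (hmax : ∀ T' : Finset (Der n), IsToral f T' → T'.card ≤ T.card)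
    {ι : Type*} {σ : ι → Der n} (hσ : Set.range σ = T) {Y : FormalCoordinates n}
    {w : ι → Fin n → ℚ} (hw : ∀ i, σ i = Y.diagDer fun j => (w i j : ℂ)) :
    (logDer f).restrictScalars ℂ ≤ Submodule.span ℂ (Set.range σ ∪ {ν | ν ∈ logDer f ∧
      IsTopNilpotentDer ν ∧ ∃ c : ι → ℚ, ∀ i, ⁅σ i, ν⁆ = (c i : ℂ) • ν}) ⊔
      (maximalIdeal (FPS n) • logDer f).restrictScalars ℂ := by
  have hσT : ∀ i, σ i ∈ T := fun i => by
    have : σ i ∈ Set.range σ := ⟨i, rfl⟩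
    rwa [hσ] at this
  have hs : ∀ i, σ i ∈ singularDer n := fun i => hf (hT.mem _ (hσT i))
  have hσw : σ = fun i => Y.diagDer fun j => (w i j : ℂ) := funext hw
  refine (le_span_weightVec_sup (logDer f) hs (adFamily_leibniz σ)
    (commute_adFamily fun i j => hT.lie_eq_zero _ (hσT i) _ (hσT j))
    (fun i x hx => lie_mem_logDer (hT.mem _ (hσT i)) hx)).trans (sup_le_sup_right ?_ _)
  rw [Submodule.span_le]
  rintro ν ⟨hν, χ, hχ⟩
  rw [SetLike.mem_coe]
  by_cases hν0 : ν = 0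
  · rw [hν0]; exact zero_mem _
  have hlie : ∀ i, ⁅σ i, ν⁆ = χ i • ν := fun i => by
    rw [hw i]
    exact Y.lie_eq_smul_of_isWeightVec (fun i j => (w i j : ℂ)) (hσw ▸ hχ) i
  -- This nonzero image has weight `χ + w · j`, which is rational; subtracting the rational `w i j`
  -- makes `χ` rational.
  obtain ⟨j, hj⟩ : ∃ j, ν (Y.coord j) ≠ 0 := by
    by_contra! h
    exact hν0 (der_eq_zero Y.span_coord h)
  have hrat : ∀ i, ∃ c : ℚ, χ i = c := by
    intro i
    have hcoord : IsWeightVec n (opFamily σ) (fun i => (w i j : ℂ)) (Y.coord j) :=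
      hσw ▸ Y.isWeightVec_coord (fun i j => (w i j : ℂ)) j
    obtain ⟨c, hc⟩ := Y.exists_rat_weight w hj (hσw ▸ hχ.der_apply hs hcoord) i
    refine ⟨c - w i j, ?_⟩
    push_cast
    rw [← hc, Pi.add_apply, add_sub_cancel_right]
  choose c hc using hrat
  by_cases hc0 : ∀ i, χ i = 0
  · obtain ⟨τ, hτ, h1, h2, h3⟩ := hT.exists_nilpotent_part hf hmax hν fun δ hδ => by
      rw [← Finset.mem_coe, ← hσ] at hδ
      obtain ⟨i, rfl⟩ := hδ
      rw [hlie, hc0, zero_smul]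
    rw [← add_sub_cancel τ ν]
    refine add_mem (Submodule.span_mono Set.subset_union_left (hσ ▸ hτ))
      (Submodule.subset_span (Or.inr ⟨h1, h2, 0, fun i => ?_⟩))
    rw [h3 _ (hσT i)]
    simp
  · push Not at hc0
    obtain ⟨i, hi⟩ := hc0
    exact Submodule.subset_span (Or.inr ⟨hν,
      isTopNilpotentDer_of_lie_eq_smul (hs i) (hf hν) hi (hlie i), c,
      fun i => by rw [hlie, hc]⟩)

end Toral

end FormalLog

/-! ### Assembly of the theorem -/

theorem mainTheorem8 (n : ℕ) (f : FormalLog.FPS n)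
    (hf : FormalLog.logDer f ≤ FormalLog.singularDer n) :
    ∃ s : ℕ, IsGreatest (FormalLog.commutingSemisimpleCounts f) s ∧
      (s = 0 → ∀ S : Set (FormalLog.Der n),
        FormalLog.IsMinimalGenerating (FormalLog.logDer f) S →
          ∀ δ ∈ S, FormalLog.IsTopNilpotentDer δ) ∧
      (s ≠ 0 → ∃ (r : ℕ) (σ : Fin s → FormalLog.Der n) (ν : Fin r → FormalLog.Der n)
          (y : FormalLog.FormalCoordinates n) (u : (FormalLog.FPS n)ˣ)
          (w : Fin s → Fin n → ℚ) (α : Fin s → ℚ) (c : Fin s → Fin r → ℚ),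
        FormalLog.IsMinimalGenerating (FormalLog.logDer f) (Set.range σ ∪ Set.range ν) ∧
        Function.Injective (Sum.elim σ ν) ∧
        (∀ i, σ i = ∑ j, (w i j : ℂ) • (y.coord j • y.partialDer j)) ∧
        (∀ i, σ i ((u : FormalLog.FPS n) * f) = (α i : ℂ) • ((u : FormalLog.FPS n) * f)) ∧
        (∀ j, FormalLog.IsTopNilpotentDer (ν j)) ∧
        (∀ i j, ⁅σ i, ν j⁆ = (c i j : ℂ) • ν j)) := by
  open FormalLog in
  have hne : (commutingSemisimpleCounts f).Nonempty :=
    ⟨0, (mem_commutingSemisimpleCounts_iff hf).2 ⟨∅, ⟨by simp, by simp, by simp, by simp⟩, rfl⟩⟩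
  have hbdd : BddAbove (commutingSemisimpleCounts f) := ⟨n, fun k hk => by
    obtain ⟨T, hT, rfl⟩ := (mem_commutingSemisimpleCounts_iff hf).1 hk
    exact hT.card_le hf⟩
  obtain ⟨s, hs⟩ : ∃ s, IsGreatest (commutingSemisimpleCounts f) s :=
    ⟨_, Nat.sSup_mem hne hbdd, fun k hk => le_csSup hbdd hk⟩
  refine ⟨s, hs, ?_⟩
  obtain ⟨T, hT, hTs⟩ := (mem_commutingSemisimpleCounts_iff hf).1 hs.1
  have hle : ∀ T' : Finset (Der n), IsToral f T' → T'.card ≤ s := fun T' hT' =>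
    hs.2 ((mem_commutingSemisimpleCounts_iff hf).2 ⟨T', hT', rfl⟩)
  constructor
  · rintro rfl S hS δ hδ
    obtain rfl := Finset.card_eq_zero.1 hTs
    have hspan : Submodule.span (FPS n) S = logDer f := hS.1
    obtain ⟨σ, hσ, -, h2, -⟩ := hT.exists_nilpotent_part hf hle
      (hspan ▸ Submodule.subset_span hδ : δ ∈ logDer f) (by simp)
    -- The semisimple part lies in the span of the empty torus.
    have hσ0 : σ = 0 := by simpa using hσ
    rwa [hσ0, sub_zero] at h2
  · intro _
    obtain ⟨T', y, u, hT', hcard, hrat⟩ := hT.exists_rational hf (hTs.symm ▸ hle)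
    rw [hTs] at hcard
    let e := T'.equivFinOfCardEq hcard
    let σ : Fin s → Der n := fun i => (e.symm i : Der n)
    have hσT : ∀ i, σ i ∈ T' := fun i => (e.symm i).2
    have hσ : Set.range σ = T' := by
      ext D
      refine ⟨fun ⟨i, hi⟩ => hi ▸ hσT i, fun hD => ⟨e ⟨D, hD⟩, by simp [σ]⟩⟩
    have hσinj : Function.Injective σ := Subtype.val_injective.comp e.symm.injective
    choose w hw using fun i => (hrat _ (hσT i)).1
    have hα : ∀ i, ∃ a : ℚ, σ i ((u : FPS n) * f) = (a : ℂ) • ((u : FPS n) * f) := by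
      choose a ha using fun i => (hrat _ (hσT i)).2
      intro i
      -- For f = 0 the eigenvalue is not determined, and 0 is chosen; otherwise it is a weight,
      -- hence rational.
      by_cases h0 : (u : FPS n) * f = 0
      · exact ⟨0, by simp [h0]⟩
      · obtain ⟨b, hb⟩ := y.exists_rat_weight w h0
          (isWeightVec_of_apply_eq fun i => by rw [← hw i]; exact ha i) i
        exact ⟨b, by rw [← hb]; exact ha i⟩
    choose α hα using hα
    -- Extend the rational torus inside the homogeneous generators; the `ν j` enumerate the rest of
    -- `S`, so they inherit nilpotency and rational weights and avoid the torus.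
    obtain ⟨S, hTS, hSG, hS⟩ := exists_isMinimalGenerating (hT'.linearIndepOn_modMax hf)
      (hσ ▸ Set.subset_union_left) (Set.union_subset (hσ ▸ hT'.mem) fun ν hν => hν.1)
      (logDer_le_span_sup hf hT' (hcard.symm ▸ hle) hσ hw)
    have hfin : (S \ T').Finite := hS.finite.subset Set.sdiff_subset
    let e' := hfin.toFinset.equivFin
    let ν : Fin hfin.toFinset.card → Der n := fun j => (e'.symm j : Der n)
    have hνS : ∀ j, ν j ∈ S \ T' := fun j => hfin.mem_toFinset.1 (e'.symm j).2
    have hν : Set.range ν = S \ T' := by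
      ext D
      refine ⟨fun ⟨i, hi⟩ => hi ▸ hνS i, fun hD => ⟨e' ⟨D, hfin.mem_toFinset.2 hD⟩, by simp [ν]⟩⟩
    have hνG : ∀ j, IsTopNilpotentDer (ν j) ∧
        ∃ c : Fin s → ℚ, ∀ i, ⁅σ i, ν j⁆ = (c i : ℂ) • ν j := by
      intro j
      rcases hSG (hνS j).1 with h | h
      · exact absurd (hσ ▸ h) (hνS j).2
      · exact h.2
    choose c hc using fun j => (hνG j).2
    refine ⟨_, σ, ν, y, u, w, α, fun i j => c j i, ?_, ?_, hw, hα, fun j => (hνG j).1,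
      fun i j => hc j i⟩
    · rwa [hσ, hν, Set.union_sdiff_cancel hTS]
    · refine hσinj.sumElim (Subtype.val_injective.comp e'.symm.injective) fun i j h => ?_
      exact (hνS j).2 (h ▸ hσT i)
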